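/- **Theorem (Second-Order Syntactic Categorical Algebraic Theory Correspondence).** *Syntax.* A (mono-sorted) second-order signature $\Sigma$ is a set of operators $\omega$, each with an arity $(n_1,\dots,n_k)\in\mathbb N^*$. Terms $\Theta \rhd \Gamma \vdash t$, with $\Theta = \mathsf m_1{:}[m_1],\dots,\mathsf m_k{:}[m_k]$ a list of metavariables and $\Gamma = x_1,\dots,x_n$ a list of variables, are built up to $\alpha$-equivalence from variables, $\mathsf m_i[t_1,\dots,t_{m_i}]$, and $\omega((\vec x_1)t_1,\dots,(\vec x_k)t_k)$, where $\vec x_i$ is a list of $n_i$ variables bound in $t_i$. Terms without operators are called elementary. Write $t\{x_i:=s_i\}$ for capture-avoiding substitution, and $t\{\mathsf m_i:=(\vec x_i)s_i\}$ for metasubstitution, which replaces $\mathsf m_i[u_1,\dots,u_{m_i}]$ by $s_i$ with the (metasubstituted) $u_j$ substituted for $\vec x_i$. A second-order equational presentation $\mathcal E=(\Sigma,E)$ is a signature with a set $E$ of equations between terms in the same context. Provable equality $\approx_{\mathcal E}$ is generated by $E$, the equivalence rules, and extended metasubstitution: from $\mathsf m_1{:}[m_1],\dots,\mathsf m_k{:}[m_k]\rhd\Gamma\vdash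 s\approx t$ and $\Theta\rhd\Delta,\vec x_i\vdash s_i\approx t_i$ ($1\le i\le k$) infer $\Theta\rhd\Gamma,\Delta\vdash s\{\mathsf m_i:=(\vec x_i)s_i\}\approx t\{\mathsf m_i:=(\vec x_i)t_i\}$. Write $[t]_{\mathcal E}$ for the class of $t$ modulo $\approx_{\mathcal E}$. *The category* $\mathbf{SOEP}$. Its objects are second-order equational presentations. A syntactic translation $\tau:\mathcal E\to\mathcal E'$ sends each operator $\omega:(m_1,\dots,m_k)$ of $\mathcal E$ to a term $\mathsf m_1{:}[m_1],\dots,\mathsf m_k{:}[m_k]\rhd\cdot\vdash\tau_\omega$ of $\mathcal E'$, in such a way that its extension to terms, given by $\tau(x)=x$, $\tau(\mathsf m[\dots t_i\dots])=\mathsf m[\dots\tau(t_i)\dots]$ and $\tau(\omega(\dots(\vec x_i)t_i\dots))=\tau_\omega\{\mathsf m_i:=(\vec x_i)\tau(t_i)\}$, sends the equations in $E$ to provable equations of $\mathcal E'$. The morphisms $\mathcal E\to\mathcal E'$ are the syntactic translations, where $\tau$ and $\tau'$ are identified if $\tau_\omega\approx_{\mathcal E'}\tau'_\omega$ for all operators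 $\omega$ of $\mathcal E$. The identity sends $\omega$ to $\iota_\omega:=\omega((\vec x_1)\mathsf m_1[\vec x_1],\dots,(\vec x_k)\mathsf m_k[\vec x_k])$, and the composite of $\tau$ and $\tau'$ sends $\omega$ to $\tau'(\tau_\omega)$. *The category* $\mathbf{SOAT}$. Let $\mathbb M$ be the category with set of objects $\mathbb N^*$ whose morphisms $(m_1,\dots,m_k)\to(n_1,\dots,n_l)$ are tuples $\langle \mathsf m_1{:}[m_1],\dots,\mathsf m_k{:}[m_k]\rhd x_1,\dots,x_{n_i}\vdash t_i\rangle_{1\le i\le l}$ of elementary terms, with identities $\langle\mathsf m_i[x_1,\dots,x_{m_i}]\rangle_i$ and composition by metasubstitution. It has finite products given by concatenation, and $(0)$ is exponentiable, with $(0)\Rightarrow(m_1,\dots,m_k)=(m_1+1,\dots,m_k+1)$ and evaluation $\langle\mathsf m_i[x_1,\dots,x_{m_i},\mathsf n[]]\rangle_i$. A second-order algebraic theory is a strict cartesian identity-on-objects functor $M:\mathbb M\to\mathcal M$ to a small cartesian category that preserves the exponentiable object $(0)$, i.e. the exponentials $(0)\Rightarrow Y$ with their evaluation maps. A morphism from $M:\mathbb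 M\to\mathcal M$ to $M':\mathbb M\to\mathcal M'$ (an algebraic translation) is a cartesian functor $F:\mathcal M\to\mathcal M'$ with $F\circ M=M'$. *The functors.* $\mathbb M(-):\mathbf{SOEP}\to\mathbf{SOAT}$ sends $\mathcal E$ to $M_{\mathcal E}:\mathbb M\to\mathbb M(\mathcal E)$, where $\mathbb M(\mathcal E)$ is defined like $\mathbb M$ but with tuples of classes $[t_i]_{\mathcal E}$ of terms of $\mathcal E$, and $M_{\mathcal E}$ sends an elementary term to its class; it sends $\tau$ to $\langle[t_i]\rangle_i\mapsto\langle[\tau(t_i)]\rangle_i$. $\mathbb{IL}(-):\mathbf{SOAT}\to\mathbf{SOEP}$ sends $M:\mathbb M\to\mathcal M$ to the presentation with an operator $\omega_f:(m_1,\dots,m_k,0^n)$ for each $f:(m_1,\dots,m_k)\to(n)$ in $\mathcal M$ and, writing $\mathsf t_f=\omega_f((\vec x_1)\mathsf m_1[\vec x_1],\dots,(\vec x_k)\mathsf m_k[\vec x_k],x_1,\dots,x_n)$, the equations $s\approx\mathsf t_{M\langle s\rangle}$ for $\langle s\rangle:(m_1,\dots,m_k)\to(n)$ in $\mathbb M$,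 and $\mathsf t_h\approx\mathsf t_g\{\mathsf m_i:=(\vec x_i)\mathsf t_{f_i}\}$ whenever $h=g\circ\langle f_1,\dots,f_l\rangle$ in $\mathcal M$; it sends $F$ to the translation $\omega_f\mapsto\widehat{\mathsf t_{Ff}}$. Here, for $\Theta\rhd x_1,\dots,x_n\vdash t$, $\widehat t:=t\{x_i:=\mathsf n_i[]\}$ in context $\Theta,\mathsf n_1{:}[0],\dots,\mathsf n_n{:}[0]\rhd\cdot$. *Claim.* The categories $\mathbf{SOAT}$ and $\mathbf{SOEP}$ are equivalent. More precisely, $\mathbb{IL}(-)$ and $\mathbb M(-)$ form an (adjoint) equivalence whose unit $\nu:\mathrm{Id}\cong\mathbb M(\mathbb{IL}(-))$ and whose counit $\varepsilon:\mathbb{IL}(\mathbb M(-))\cong\mathrm{Id}$ are the following isomorphisms: $\nu_M:\mathcal M\to\mathbb M(\mathbb{IL}(M))$ sends $f=\langle f_1,\dots,f_l\rangle$ to $\langle[\mathsf t_{f_1}],\dots,[\mathsf t_{f_l}]\rangle$; the inverse of $\varepsilon_{\mathcal E}$ sends an operator $\omega$ of $\mathcal E$ to $\mathsf t_{\langle[\iota_\omega]_{\mathcal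 E}\rangle}$, and $\varepsilon_{\mathcal E}$ sends $\omega_{\langle[t]_{\mathcal E}\rangle}$ to $\widehat t$. -/

import Mathlib

open CategoryTheory CategoryTheory.Limits

universe u v w

namespace SecondOrder

/-- A (mono-sorted) second-order signature: a set of operators, each with an arity
`(n₁, …, nₖ)`; the `i`-th argument of the operator binds `nᵢ` variables. -/
structure Sig : Type (u + 1) where
  Op : Type u
  arity : Op → List ℕ

/-- `Pos Θ m` is the set of positions in the list `Θ` whose entry is `m`. A list `Θ` is read as a
metavariable context `𝗆₁ : [m₁], …, 𝗆ₖ : [mₖ]` and `Pos Θ m` as its metavariables of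
meta-arity `m`. -/
inductive Pos : List ℕ → ℕ → Type
  | head {m : ℕ} {Θ : List ℕ} : Pos (m :: Θ) m
  | tail {k m : ℕ} {Θ : List ℕ} (p : Pos Θ m) : Pos (k :: Θ) m

/-- Second-order terms `Θ ▷ x₁, …, xₙ ⊢ t` up to `α`-equivalence (well-scoped de Bruijn form):
`Tm S Θ n`. The `m` variables bound in an argument of an operator are the last `m` variables of
the context `n + m` of that argument. -/
inductive Tm (S : Sig.{u}) (Θ : List ℕ) : ℕ → Type u
  | var {n : ℕ} (x : Fin n) : Tm S Θ n
  | mvar {n m : ℕ} (p : Pos Θ m) (ts : Fin m → Tm S Θ n) : Tm S Θ n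
  | op {n : ℕ} (ω : S.Op) (ts : ∀ m : ℕ, Pos (S.arity ω) m → Tm S Θ (n + m)) : Tm S Θ n

namespace Tm

variable {S : Sig.{u}} {Θ Ξ Ψ : List ℕ} {n m l d : ℕ}

/-- Extension of a renaming to `k` further (bound) variables. -/
def liftR (k : ℕ) (ρ : Fin n → Fin m) : Fin (n + k) → Fin (m + k) :=
  Fin.addCases (fun i => Fin.castAdd k (ρ i)) (fun j => Fin.natAdd m j)

/-- Renaming (in particular weakening) of variables. -/
def rename : {n m : ℕ} → (Fin n → Fin m) → Tm S Θ n → Tm S Θ m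
  | _, _, ρ, var x => var (ρ x)
  | _, _, ρ, mvar p ts => mvar p (fun j => rename ρ (ts j))
  | _, _, ρ, op ω ts => op ω (fun k p => rename (liftR k ρ) (ts k p))

/-- Extension of a substitution to `k` further (bound) variables, avoiding capture. -/
def liftS (k : ℕ) (θ : Fin n → Tm S Θ m) : Fin (n + k) → Tm S Θ (m + k) :=
  Fin.addCases (fun i => rename (Fin.castAdd k) (θ i)) (fun j => var (Fin.natAdd m j))

/-- Capture-avoiding simultaneous substitution `t{xᵢ := θᵢ}` of terms for variables. -/
def subst : {n m : ℕ} → (Fin n → Tm S Θ m) → Tm S Θ n → Tm S Θ m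
  | _, _, θ, var x => θ x
  | _, _, θ, mvar p ts => mvar p (fun j => subst θ (ts j))
  | _, _, θ, op ω ts => op ω (fun k p => subst (liftS k θ) (ts k p))

/-- Weakening by `k` variables of the abstracted terms `Γ, x⃗ ⊢ σ` of a metasubstitution:
`Γ, x⃗ ⊢ σ` becomes `Γ, y₁, …, yₖ, x⃗ ⊢ σ`. -/
def wk (k : ℕ) (σ : ∀ m : ℕ, Pos Θ m → Tm S Ξ (n + m)) (m : ℕ) (p : Pos Θ m) :
    Tm S Ξ (n + k + m) :=
  rename (liftR m (Fin.castAdd k)) (σ m p)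

/-- Metasubstitution `t{𝗆ᵢ := (x⃗ᵢ) σᵢ}` of abstracted terms `Ξ ▷ Γ, x⃗ᵢ ⊢ σᵢ` for the
metavariables of `Θ ▷ Γ ⊢ t`, giving a term in context `Ξ ▷ Γ`. -/
def msubst : {n : ℕ} → (∀ m : ℕ, Pos Θ m → Tm S Ξ (n + m)) → Tm S Θ n → Tm S Ξ n
  | _, _, var x => var x
  | _, σ, mvar p ts => subst (Fin.addCases var (fun j => msubst σ (ts j))) (σ _ p)
  | _, σ, op ω ts => op ω (fun k p => msubst (wk k σ) (ts k p))

/-! ### The substitution calculus -/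

@[simp] theorem liftR_castAdd (k : ℕ) (ρ : Fin n → Fin m) (i : Fin n) :
    liftR k ρ (Fin.castAdd k i) = Fin.castAdd k (ρ i) := by simp [liftR]

@[simp] theorem liftR_natAdd (k : ℕ) (ρ : Fin n → Fin m) (i : Fin k) :
    liftR k ρ (Fin.natAdd n i) = Fin.natAdd m i := by simp [liftR]

@[simp] theorem liftS_castAdd (k : ℕ) (θ : Fin n → Tm S Θ m) (i : Fin n) :
    liftS k θ (Fin.castAdd k i) = rename (Fin.castAdd k) (θ i) := by simp [liftS]

@[simp] theorem liftS_natAdd (k : ℕ) (θ : Fin n → Tm S Θ m) (i : Fin k) :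
    liftS k θ (Fin.natAdd n i) = var (Fin.natAdd m i) := by simp [liftS]

theorem fin_ext {α : Sort*} {n k : ℕ} {f g : Fin (n + k) → α}
    (h₁ : ∀ i : Fin n, f (Fin.castAdd k i) = g (Fin.castAdd k i))
    (h₂ : ∀ j : Fin k, f (Fin.natAdd n j) = g (Fin.natAdd n j)) : f = g := by
  funext i
  exact Fin.addCases h₁ h₂ i

theorem rename_rename (t : Tm S Θ n) (ρ : Fin n → Fin m) (ρ₂ : Fin m → Fin l) :
    rename ρ₂ (rename ρ t) = rename (fun i => ρ₂ (ρ i)) t := by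
  induction t generalizing m l with
  | var x => rfl
  | mvar p ts ih => simp [rename, ih]
  | op ω ts ih =>
    simp only [rename, ih]
    congr; funext k p
    congr 1
    exact fin_ext (by simp) (by simp)

theorem subst_rename (t : Tm S Θ n) (ρ : Fin n → Fin m) (θ : Fin m → Tm S Θ l) :
    subst θ (rename ρ t) = subst (fun i => θ (ρ i)) t := by
  induction t generalizing m l with
  | var x => rfl
  | mvar p ts ih => simp [rename, subst, ih]
  | op ω ts ih =>
    simp only [rename, subst, ih]
    congr; funext k p
    congr 1
    exact fin_ext (by simp) (by simp)

theorem rename_subst (t : Tm S Θ n) (θ : Fin n → Tm S Θ m) (ρ : Fin m → Fin l) :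
    rename ρ (subst θ t) = subst (fun i => rename ρ (θ i)) t := by
  induction t generalizing m l with
  | var x => rfl
  | mvar p ts ih => simp [rename, subst, ih]
  | op ω ts ih =>
    simp only [rename, subst, ih]
    congr; funext k p
    congr 1
    exact fin_ext (by simp [rename_rename]) (by simp [rename])

theorem subst_subst (t : Tm S Θ n) (θ : Fin n → Tm S Θ m) (θ₂ : Fin m → Tm S Θ l) :
    subst θ₂ (subst θ t) = subst (fun i => subst θ₂ (θ i)) t := by
  induction t generalizing m l with
  | var x => rfl
  | mvar p ts ih => simp [subst, ih]
  | op ω ts ih =>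
    simp only [subst, ih]
    congr; funext k p
    congr 1
    exact fin_ext (by simp [rename_subst, subst_rename]) (by simp [subst])

theorem liftS_var (k : ℕ) : liftS k (var : Fin n → Tm S Θ n) = var :=
  fin_ext (by simp [rename]) (by simp)

theorem subst_var (t : Tm S Θ n) : subst var t = t := by
  induction t with
  | var x => rfl
  | mvar p ts ih => simp [subst, ih]
  | op ω ts ih => simp [subst, ih, liftS_var]

theorem rename_eq_subst (t : Tm S Θ n) (ρ : Fin n → Fin m) :
    rename ρ t = subst (fun i => var (ρ i)) t := by
  rw [← subst_rename t ρ var, subst_var]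

/-- Simultaneous substitution and metasubstitution (auxiliary). -/
def ginst : {n m : ℕ} → (Fin n → Tm S Ξ m) → (∀ k : ℕ, Pos Θ k → Tm S Ξ (m + k)) →
    Tm S Θ n → Tm S Ξ m
  | _, _, γ, _, var x => γ x
  | _, _, γ, σ, mvar p ts => subst (Fin.addCases var (fun j => ginst γ σ (ts j))) (σ _ p)
  | _, _, γ, σ, op ω ts => op ω (fun k p => ginst (liftS k γ) (wk k σ) (ts k p))

theorem msubst_eq (σ : ∀ m : ℕ, Pos Θ m → Tm S Ξ (n + m)) (t : Tm S Θ n) :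
    msubst σ t = ginst var σ t := by
  induction t with
  | var x => rfl
  | mvar p ts ih => simp [msubst, ginst, ih]
  | op ω ts ih => simp [msubst, ginst, ih, liftS_var]

/-- The metasubstitution replacing each metavariable by itself. -/
def mid (m : ℕ) (p : Pos Θ m) : Tm S Θ (n + m) := mvar p (fun j => var (Fin.natAdd n j))

theorem wk_mid (k : ℕ) : wk k (mid : ∀ m : ℕ, Pos Θ m → Tm S Θ (n + m)) = mid := by
  funext m p
  simp [wk, mid, rename]

theorem subst_eq (θ : Fin n → Tm S Θ m) (t : Tm S Θ n) : subst θ t = ginst θ mid t := by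
  induction t generalizing m with
  | var x => rfl
  | mvar p ts ih => simp [subst, ginst, ih, mid]
  | op ω ts ih => simp [subst, ginst, ih, wk_mid]

theorem rename_ginst (t : Tm S Θ n) (γ : Fin n → Tm S Ξ m)
    (σ : ∀ k : ℕ, Pos Θ k → Tm S Ξ (m + k)) (ρ : Fin m → Fin l) :
    rename ρ (ginst γ σ t) =
      ginst (fun i => rename ρ (γ i)) (fun k p => rename (liftR k ρ) (σ k p)) t := by
  induction t generalizing m l with
  | var x => rfl
  | mvar p ts ih =>
    simp only [ginst, rename_subst, subst_rename]
    congr 1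
    exact fin_ext (by simp [rename]) (by simp [ih])
  | op ω ts ih =>
    simp only [rename, ginst, ih]
    congr; funext k p
    congr 1
    · exact fin_ext (by simp [rename_rename]) (by simp [rename])
    · funext q r
      simp only [wk, rename_rename]
      congr 1
      exact fin_ext (by simp) (by simp)

theorem subst_ginst (t : Tm S Θ n) (γ : Fin n → Tm S Ξ m)
    (σ : ∀ k : ℕ, Pos Θ k → Tm S Ξ (m + k)) (θ : Fin m → Tm S Ξ l) :
    subst θ (ginst γ σ t) =
      ginst (fun i => subst θ (γ i)) (fun k p => subst (liftS k θ) (σ k p)) t := by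
  induction t generalizing m l with
  | var x => rfl
  | mvar p ts ih =>
    simp only [ginst, subst_subst]
    congr 1
    refine fin_ext (fun i => ?_) (by simp [ih, subst])
    simp [subst, subst_rename, subst_var]
  | op ω ts ih =>
    simp only [subst, ginst, ih]
    congr; funext k p
    congr 1
    · exact fin_ext (by simp [rename_subst, subst_rename]) (by simp [subst])
    · funext q r
      simp only [wk, rename_subst, subst_rename]
      congr 1
      exact fin_ext (by simp [rename_rename]) (by simp [rename])

theorem ginst_rename (t : Tm S Θ d) (ρ : Fin d → Fin n) (γ : Fin n → Tm S Ξ m)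
    (σ : ∀ k : ℕ, Pos Θ k → Tm S Ξ (m + k)) :
    ginst γ σ (rename ρ t) = ginst (fun i => γ (ρ i)) σ t := by
  induction t generalizing m n with
  | var x => rfl
  | mvar p ts ih => simp [rename, ginst, ih]
  | op ω ts ih =>
    simp only [rename, ginst, ih]
    congr; funext k p
    congr 1
    exact fin_ext (by simp) (by simp)

theorem ginst_subst (t : Tm S Θ d) (θ : Fin d → Tm S Θ n) (γ : Fin n → Tm S Ξ m)
    (σ : ∀ k : ℕ, Pos Θ k → Tm S Ξ (m + k)) :
    ginst γ σ (subst θ t) = ginst (fun i => ginst γ σ (θ i)) σ t := by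
  induction t generalizing m n with
  | var x => rfl
  | mvar p ts ih => simp [subst, ginst, ih]
  | op ω ts ih =>
    simp only [subst, ginst, ih]
    congr; funext k p
    congr 1
    refine fin_ext (fun i => ?_) (by simp [ginst])
    simp only [liftS_castAdd, ginst_rename, rename_ginst]
    rfl

theorem ginst_ginst (t : Tm S Θ d) (γ : Fin d → Tm S Ξ n)
    (σ : ∀ k : ℕ, Pos Θ k → Tm S Ξ (n + k)) (γ₂ : Fin n → Tm S Ψ m)
    (σ₂ : ∀ k : ℕ, Pos Ξ k → Tm S Ψ (m + k)) :
    ginst γ₂ σ₂ (ginst γ σ t) =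
      ginst (fun i => ginst γ₂ σ₂ (γ i))
        (fun k p => ginst (liftS k γ₂) (wk k σ₂) (σ k p)) t := by
  induction t generalizing m n with
  | var x => rfl
  | mvar p ts ih =>
    simp only [ginst, ginst_subst, subst_ginst]
    congr 1
    · refine fin_ext (fun i => ?_) (by simp [ih, subst])
      simp [ginst, subst_rename, subst_var]
    · funext k q
      simp only [wk, subst_rename]
      conv_lhs => rw [← subst_var (σ₂ k q)]
      congr 1
      exact fin_ext (by simp [rename]) (by simp)
  | op ω ts ih =>
    simp only [ginst, ih]
    congr; funext k p
    congr 1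
    · refine fin_ext (fun i => ?_) (by simp [ginst])
      simp only [liftS_castAdd, ginst_rename, rename_ginst]
      rfl
    · funext q r
      simp only [wk, ginst_rename, rename_ginst]
      congr 1
      · exact fin_ext (by simp [rename_rename]) (by simp [rename])
      · funext a b
        simp only [wk, rename_rename]
        congr 1
        exact fin_ext (by simp) (by simp)

theorem ginst_mid (t : Tm S Θ n) : ginst var mid t = t := by
  rw [← subst_eq, subst_var]

/-! ### Extension of signature translations to terms -/

variable {S₁ : Sig.{u}} {S₂ : Sig.{v}} {S₃ : Sig.{w}}

/-- Extension to all terms of a translation of the operators of `S₁` to terms of `S₂`: the operator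
`ω : (m₁, …, mₖ)` is sent to a term `𝗆₁ : [m₁], …, 𝗆ₖ : [mₖ] ▷ · ⊢ τ ω`. -/
def translate (τ : ∀ ω : S₁.Op, Tm S₂ (S₁.arity ω) 0) : {n : ℕ} → Tm S₁ Θ n → Tm S₂ Θ n
  | _, var x => var x
  | _, mvar p ts => mvar p (fun j => translate τ (ts j))
  | _, op ω ts => msubst (fun k p => translate τ (ts k p)) (rename Fin.elim0 (τ ω))

theorem translate_op (τ : ∀ ω : S₁.Op, Tm S₂ (S₁.arity ω) 0) (ω : S₁.Op)
    (ts : ∀ m : ℕ, Pos (S₁.arity ω) m → Tm S₁ Θ (n + m)) :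
    translate τ (op ω ts) = ginst Fin.elim0 (fun k p => translate τ (ts k p)) (τ ω) := by
  simp only [translate, msubst_eq, ginst_rename]
  congr 1
  exact funext fun i => i.elim0

theorem translate_rename (τ : ∀ ω : S₁.Op, Tm S₂ (S₁.arity ω) 0) (t : Tm S₁ Θ n)
    (ρ : Fin n → Fin m) : translate τ (rename ρ t) = rename ρ (translate τ t) := by
  induction t generalizing m with
  | var x => rfl
  | mvar p ts ih => simp [rename, translate, ih]
  | op ω ts ih =>
    simp only [rename, translate_op, ih, rename_ginst]
    congr 1
    exact funext fun i => i.elim0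

theorem translate_liftS (τ : ∀ ω : S₁.Op, Tm S₂ (S₁.arity ω) 0) (k : ℕ)
    (θ : Fin n → Tm S₁ Θ m) (i : Fin (n + k)) :
    translate τ (liftS k θ i) = liftS k (fun i => translate τ (θ i)) i := by
  refine congrFun (f := fun i => translate τ (liftS k θ i)) (fin_ext (fun i => ?_) ?_) i
  · simp [translate_rename]
  · simp [translate]

theorem translate_subst (τ : ∀ ω : S₁.Op, Tm S₂ (S₁.arity ω) 0) (t : Tm S₁ Θ n)
    (θ : Fin n → Tm S₁ Θ m) :
    translate τ (subst θ t) = subst (fun i => translate τ (θ i)) (translate τ t) := by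
  induction t generalizing m with
  | var x => rfl
  | mvar p ts ih => simp [subst, translate, ih]
  | op ω ts ih =>
    simp only [subst, translate_op, ih, subst_ginst, translate_liftS]
    congr 1
    exact funext fun i => i.elim0

theorem translate_ginst (τ : ∀ ω : S₁.Op, Tm S₂ (S₁.arity ω) 0) (t : Tm S₁ Θ n)
    (γ : Fin n → Tm S₁ Ξ m) (σ : ∀ k : ℕ, Pos Θ k → Tm S₁ Ξ (m + k)) :
    translate τ (ginst γ σ t) =
      ginst (fun i => translate τ (γ i)) (fun k p => translate τ (σ k p)) (translate τ t) := by
  induction t generalizing m with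
  | var x => rfl
  | mvar p ts ih =>
    simp only [ginst, translate, translate_subst]
    congr 1
    exact fin_ext (by simp [translate]) (by simp [ih])
  | op ω ts ih =>
    simp only [ginst, translate_op, ih, ginst_ginst, wk, translate_rename, translate_liftS]
    congr 1
    exact funext fun i => i.elim0

theorem translate_msubst (τ : ∀ ω : S₁.Op, Tm S₂ (S₁.arity ω) 0) (t : Tm S₁ Θ n)
    (σ : ∀ k : ℕ, Pos Θ k → Tm S₁ Ξ (n + k)) :
    translate τ (msubst σ t) = msubst (fun k p => translate τ (σ k p)) (translate τ t) := by
  simp only [msubst_eq, translate_ginst]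
  rfl

/-- The term `𝗆₁ : [m₁], …, 𝗆ₖ : [mₖ] ▷ · ⊢ ω((x⃗₁) 𝗆₁[x⃗₁], …, (x⃗ₖ) 𝗆ₖ[x⃗ₖ])`. -/
def gen (ω : S₁.Op) : Tm S₁ (S₁.arity ω) 0 :=
  op ω (fun k p => mvar p (fun j => var (Fin.natAdd 0 j)))

theorem op_eq_ginst (ω : S₁.Op) (ts : ∀ m : ℕ, Pos (S₁.arity ω) m → Tm S₁ Θ (n + m)) :
    op ω ts = ginst Fin.elim0 ts (gen ω) := by
  simp only [gen, ginst]
  congr; funext k p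
  simp only [wk, subst_rename]
  conv_lhs => rw [← subst_var (ts k p)]
  congr 1
  exact fin_ext (by simp) (fun j => by rw [liftR_natAdd, Fin.addCases_right, liftS_natAdd])

theorem translate_gen (t : Tm S₁ Θ n) : translate gen t = t := by
  induction t with
  | var x => rfl
  | mvar p ts ih => simp [translate, ih]
  | op ω ts ih => simp only [translate_op, ih, ← op_eq_ginst]

theorem translate_gen_op (τ : ∀ ω : S₁.Op, Tm S₂ (S₁.arity ω) 0) (ω : S₁.Op) :
    translate τ (gen ω) = τ ω := by
  simp only [gen, translate_op, translate]
  conv_rhs => rw [← ginst_mid (τ ω)]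
  congr 1
  exact funext fun i => i.elim0

theorem translate_translate (τ : ∀ ω : S₁.Op, Tm S₂ (S₁.arity ω) 0)
    (τ₂ : ∀ ω : S₂.Op, Tm S₃ (S₂.arity ω) 0) (t : Tm S₁ Θ n) :
    translate τ₂ (translate τ t) = translate (fun ω => translate τ₂ (τ ω)) t := by
  induction t with
  | var x => rfl
  | mvar p ts ih => simp [translate, ih]
  | op ω ts ih =>
    simp only [translate_op, translate_ginst, ih]
    congr 1
    exact funext fun i => i.elim0

end Tm

/-- The signature without operators. -/
def Sig.empty : Sig.{0} := ⟨Empty, Empty.elim⟩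

/-- Elementary terms: built from variables and metavariables only. -/
abbrev ElemTm (Θ : List ℕ) (n : ℕ) : Type := Tm Sig.empty Θ n

/-- Elementary terms are terms over every signature. -/
def Tm.ofElem {S : Sig.{u}} {Θ : List ℕ} {n : ℕ} (t : ElemTm Θ n) : Tm S Θ n :=
  Tm.translate (fun ω : Sig.empty.Op => Empty.elim ω) t

theorem Tm.translate_ofElem {S : Sig.{u}} {S₂ : Sig.{v}} (τ : ∀ ω : S.Op, Tm S₂ (S.arity ω) 0)
    {Θ : List ℕ} {n : ℕ} (t : ElemTm Θ n) : translate τ (ofElem t) = ofElem t := by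
  unfold ofElem
  rw [translate_translate]
  congr 1
  exact funext fun i => Empty.elim i

/-! ### Equational presentations and second-order equational logic -/

/-- A second-order equational presentation: a signature and a set of equations (in context) over
it, the basic equations of the presentation. -/
structure Presentation : Type (u + 1) where
  sig : Sig.{u}
  Ax : ∀ {Θ : List ℕ} {n : ℕ}, Tm sig Θ n → Tm sig Θ n → Prop

open Tm

/-- Second-order equational logic: `Der E s t` means that `Θ ▷ Γ ⊢ s ≈ t` is derivable from the
equations of `E`. The last rule is extended metasubstitution: from `Θ ▷ Γ ⊢ s ≈ t` and
`Ξ ▷ Δ, x⃗ᵢ ⊢ σᵢ ≈ σ₂ᵢ` infer `Ξ ▷ Γ, Δ ⊢ s{𝗆ᵢ := (x⃗ᵢ) σᵢ} ≈ t{𝗆ᵢ := (x⃗ᵢ) σ₂ᵢ}`, where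
`Γ` has `n` and `Δ` has `d` variables and all terms are weakened to `Γ, Δ`. -/
inductive Der (E : Presentation.{u}) :
    ∀ {Θ : List ℕ} {n : ℕ}, Tm E.sig Θ n → Tm E.sig Θ n → Prop
  | ax {Θ : List ℕ} {n : ℕ} {s t : Tm E.sig Θ n} : E.Ax s t → Der E s t
  | refl {Θ : List ℕ} {n : ℕ} (t : Tm E.sig Θ n) : Der E t t
  | symm {Θ : List ℕ} {n : ℕ} {s t : Tm E.sig Θ n} : Der E s t → Der E t s
  | trans {Θ : List ℕ} {n : ℕ} {s t r : Tm E.sig Θ n} : Der E s t → Der E t r → Der E s r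
  | msubst {Θ Ξ : List ℕ} {n d : ℕ} {s t : Tm E.sig Θ n}
      {σ σ₂ : ∀ m : ℕ, Pos Θ m → Tm E.sig Ξ (d + m)} :
      Der E s t → (∀ (m : ℕ) (p : Pos Θ m), Der E (σ m p) (σ₂ m p)) →
      Der E
        (Tm.msubst (fun m p => rename (liftR m (Fin.natAdd n)) (σ m p))
          (rename (Fin.castAdd d) s))
        (Tm.msubst (fun m p => rename (liftR m (Fin.natAdd n)) (σ₂ m p))
          (rename (Fin.castAdd d) t))

namespace Pos

variable {Θ Ξ : List ℕ} {m : ℕ}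

/-- Positions of `Θ` as positions of `Θ ++ Ξ`. -/
def inl : {Θ Ξ : List ℕ} → {m : ℕ} → Pos Θ m → Pos (Θ ++ Ξ) m
  | _, _, _, head => head
  | _, _, _, tail p => tail (inl p)

/-- Positions of `Ξ` as positions of `Θ ++ Ξ`. -/
def inr : (Θ : List ℕ) → {Ξ : List ℕ} → {m : ℕ} → Pos Ξ m → Pos (Θ ++ Ξ) m
  | [], _, _, p => p
  | _ :: Θ, _, _, p => tail (inr Θ p)

/-- Concatenation of a tuple indexed by `Θ` and a tuple indexed by `Ξ`. -/
def app {F : ℕ → Type u} : (Θ : List ℕ) → {Ξ : List ℕ} → (a : ∀ m : ℕ, Pos Θ m → F m) →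
    (b : ∀ m : ℕ, Pos Ξ m → F m) → (m : ℕ) → Pos (Θ ++ Ξ) m → F m
  | [], _, _, b, m, p => b m p
  | _ :: _, _, a, _, _, head => a _ head
  | _ :: Θ, _, a, b, _, tail p => app Θ (fun k q => a k (tail q)) b _ p

@[simp] theorem app_inl {F : ℕ → Type u} (a : ∀ m : ℕ, Pos Θ m → F m)
    (b : ∀ m : ℕ, Pos Ξ m → F m) (p : Pos Θ m) : app Θ a b m (inl p) = a m p := by
  induction p with
  | head => rfl
  | tail p ih => exact ih (fun k q => a k (tail q))

@[simp] theorem app_inr {F : ℕ → Type u} (a : ∀ m : ℕ, Pos Θ m → F m)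
    (b : ∀ m : ℕ, Pos Ξ m → F m) (p : Pos Ξ m) : app Θ a b m (inr Θ p) = b m p := by
  induction Θ with
  | nil => rfl
  | cons k Θ ih => exact ih (fun k q => a k (tail q))

theorem app_ind {P : ∀ m : ℕ, Pos (Θ ++ Ξ) m → Prop}
    (h₁ : ∀ (m : ℕ) (p : Pos Θ m), P m (inl p)) (h₂ : ∀ (m : ℕ) (p : Pos Ξ m), P m (inr Θ p))
    (m : ℕ) (p : Pos (Θ ++ Ξ) m) : P m p := by
  induction Θ with
  | nil => exact h₂ m p
  | cons k Θ ih =>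
    cases p with
    | head => exact h₁ _ head
    | tail p => exact ih (P := fun m p => P m (tail p)) (fun m p => h₁ m (tail p)) h₂ p

/-- The tuple with the single entry `t`, indexed by `(n)`. -/
def single {F : ℕ → Type u} {n : ℕ} (t : F n) : (m : ℕ) → Pos [n] m → F m
  | _, head => t

/-- The `i`-th position of the sequence `k, …, k` of length `n`. -/
def rep {k : ℕ} : {n : ℕ} → Fin n → Pos (List.replicate n k) k
  | 0, i => i.elim0
  | _ + 1, i => Fin.cases head (fun j => tail (rep j)) i

/-- The tuple indexed by the sequence `k, …, k` of length `n` with entries `b i`. -/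
def reps {F : ℕ → Type u} {k : ℕ} :
    {n : ℕ} → (Fin n → F k) → (m : ℕ) → Pos (List.replicate n k) m → F m
  | _ + 1, b, _, head => b 0
  | _ + 1, b, _, tail p => reps (fun j => b j.succ) _ p

@[simp] theorem reps_rep {F : ℕ → Type u} {n k : ℕ} (b : Fin n → F k) (i : Fin n) :
    reps b k (rep i) = b i := by
  induction n with
  | zero => exact i.elim0
  | succ n ih =>
    refine Fin.cases ?_ (fun j => ?_) i
    · rfl
    · exact ih (fun j => b j.succ) j

theorem reps_ind {n k : ℕ} {P : ∀ m : ℕ, Pos (List.replicate n k) m → Prop}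
    (h : ∀ i : Fin n, P k (rep i)) (m : ℕ) (p : Pos (List.replicate n k) m) : P m p := by
  induction n with
  | zero => cases p
  | succ n ih =>
    cases p with
    | head => exact h 0
    | tail p => exact ih (P := fun m p => P m (tail p)) (fun i => h i.succ) p

/-- The position in `(m₁ + 1, …, mₖ + 1)` that corresponds to a position in `(m₁, …, mₖ)`. -/
def up : {Θ : List ℕ} → {m : ℕ} → Pos Θ m → Pos (Θ.map (· + 1)) (m + 1)
  | _, _, head => head
  | _, _, tail p => tail (up p)

/-- Tuples indexed by `(m₁ + 1, …, mₖ + 1)`. -/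
def ups {F : ℕ → Type u} : {Θ : List ℕ} → (∀ m : ℕ, Pos Θ m → F (m + 1)) →
    (m : ℕ) → Pos (Θ.map (· + 1)) m → F m
  | _ :: _, a, _, head => a _ head
  | _ :: _, a, _, tail p => ups (fun k q => a k (tail q)) _ p

@[simp] theorem ups_up {F : ℕ → Type u} (a : ∀ m : ℕ, Pos Θ m → F (m + 1)) (p : Pos Θ m) :
    ups a _ (up p) = a m p := by
  induction p with
  | head => rfl
  | tail p ih => exact ih (fun k q => a k (tail q))

theorem ups_ind {P : ∀ m : ℕ, Pos (Θ.map (· + 1)) m → Prop}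
    (h : ∀ (m : ℕ) (p : Pos Θ m), P (m + 1) (up p)) (m : ℕ) (p : Pos (Θ.map (· + 1)) m) :
    P m p := by
  induction Θ with
  | nil => cases p
  | cons k Θ ih =>
    cases p with
    | head => exact h _ head
    | tail p => exact ih (P := fun m p => P m (tail p)) (fun m p => h m (tail p)) p

end Pos

namespace Der

variable {E : Presentation.{u}} {Θ Ξ : List ℕ} {n m : ℕ}

theorem shift {s t : Tm E.sig Θ n} (h : Der E s t) :
    Der E (rename (Fin.natAdd 0) s) (rename (Fin.natAdd 0) t) := by
  have key : ∀ (k : ℕ) (e : n = k), Der E (rename (Fin.cast e) s) (rename (Fin.cast e) t) := by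
    rintro k rfl
    have : (Fin.cast rfl : Fin n → Fin n) = fun i => i := rfl
    rw [this, rename_eq_subst, rename_eq_subst, subst_var, subst_var]
    exact h
  have e : (Fin.natAdd 0 : Fin n → Fin (0 + n)) = Fin.cast (Nat.zero_add n).symm := by
    funext i; ext; simp
  rw [e]
  exact key _ _

theorem subst {s t : Tm E.sig Θ n} (h : Der E s t) {θ θ₂ : Fin n → Tm E.sig Θ m}
    (hθ : ∀ i, Der E (θ i) (θ₂ i)) : Der E (Tm.subst θ s) (Tm.subst θ₂ t) := by
  let g : Tm E.sig (n :: List.replicate n m) m :=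
    .mvar .head (fun i => .mvar (.tail (Pos.rep i)) .var)
  let Sg : Tm E.sig Θ n → (Fin n → Tm E.sig Θ m) → ∀ k : ℕ, Pos (n :: List.replicate n m) k →
      Tm E.sig Θ (0 + k) := fun s θ k p =>
    Pos.app (F := fun k => Tm E.sig Θ (0 + k)) [n]
      (Pos.single (F := fun k => Tm E.sig Θ (0 + k)) (rename (Fin.natAdd 0) s))
      (Pos.reps (F := fun k => Tm E.sig Θ (0 + k)) fun i => rename (Fin.natAdd 0) (θ i)) k p
  have key : ∀ s θ, Tm.msubst (fun k p => rename (liftR k (Fin.natAdd m)) (Sg s θ k p))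
      (rename (Fin.castAdd 0) g) = Tm.subst θ s := by
    intro s θ
    have h1 : Sg s θ _ .head = rename (Fin.natAdd 0) s := rfl
    have h2 : ∀ i, Sg s θ _ (.tail (Pos.rep i)) = rename (Fin.natAdd 0) (θ i) := fun i =>
      Pos.reps_rep (F := fun k => Tm E.sig Θ (0 + k)) (fun i => rename (Fin.natAdd 0) (θ i)) i
    simp only [g, rename, Tm.msubst, h1, h2, rename_rename, subst_rename, liftR_natAdd,
      Fin.addCases_right]
    congr 1
    funext i
    exact subst_var _
  rw [← key s θ, ← key t θ₂]
  refine Der.msubst (Der.refl g) ?_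
  intro k p
  cases p with
  | head => exact h.shift
  | tail p =>
    refine Pos.reps_ind (P := fun k p => Der E (Sg s θ k (.tail p)) (Sg t θ₂ k (.tail p)))
      (fun i => ?_) k p
    have h2 : ∀ s θ, Sg s θ _ (.tail (Pos.rep i)) = rename (Fin.natAdd 0) (θ i) := fun s θ =>
      Pos.reps_rep (F := fun k => Tm E.sig Θ (0 + k)) (fun i => rename (Fin.natAdd 0) (θ i)) i
    rw [h2, h2]
    exact (hθ i).shift

theorem rename {s t : Tm E.sig Θ n} (h : Der E s t) (ρ : Fin n → Fin m) :
    Der E (Tm.rename ρ s) (Tm.rename ρ t) := by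
  rw [rename_eq_subst, rename_eq_subst]
  exact h.subst fun i => .refl _

theorem ginst {s t : Tm E.sig Θ n} (h : Der E s t) {γ γ₂ : Fin n → Tm E.sig Ξ m}
    (hγ : ∀ i, Der E (γ i) (γ₂ i)) {σ σ₂ : ∀ k : ℕ, Pos Θ k → Tm E.sig Ξ (m + k)}
    (hσ : ∀ k p, Der E (σ k p) (σ₂ k p)) : Der E (Tm.ginst γ σ s) (Tm.ginst γ₂ σ₂ t) := by
  have key : ∀ (s : Tm E.sig Θ n) (γ : Fin n → Tm E.sig Ξ m)
      (σ : ∀ k : ℕ, Pos Θ k → Tm E.sig Ξ (m + k)),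
      Tm.subst (Fin.addCases γ .var) (Tm.msubst
        (fun k p => Tm.rename (liftR k (Fin.natAdd n)) (σ k p))
        (Tm.rename (Fin.castAdd m) s)) = Tm.ginst γ σ s := by
    intro s γ σ
    simp only [msubst_eq, ginst_rename, subst_ginst, Tm.subst, Fin.addCases_left, subst_rename]
    congr 1
    funext k p
    conv_rhs => rw [← subst_var (σ k p)]
    congr 1
    exact fin_ext (by simp [Tm.rename]) (by simp)
  rw [← key s γ σ, ← key t γ₂ σ₂]
  refine (Der.msubst h hσ).subst (fun i => ?_)
  refine Fin.addCases (fun i => ?_) (fun i => ?_) i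
  · simpa using hγ i
  · simpa using Der.refl _

theorem op (ω : E.sig.Op) {ts ts₂ : ∀ k : ℕ, Pos (E.sig.arity ω) k → Tm E.sig Θ (n + k)}
    (h : ∀ k p, Der E (ts k p) (ts₂ k p)) : Der E (Tm.op ω ts) (Tm.op ω ts₂) := by
  rw [op_eq_ginst, op_eq_ginst]
  exact (Der.refl _).ginst (fun i => i.elim0) h

theorem mvar {k : ℕ} (p : Pos Θ k) {ts ts₂ : Fin k → Tm E.sig Θ n}
    (h : ∀ j, Der E (ts j) (ts₂ j)) : Der E (Tm.mvar p ts) (Tm.mvar p ts₂) :=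
  (Der.refl (Tm.mvar p Tm.var : Tm E.sig Θ k)).subst h

end Der

/-- Provable equality in `E`. -/
def derSetoid (E : Presentation.{u}) (Θ : List ℕ) (n : ℕ) : Setoid (Tm E.sig Θ n) where
  r := Der E
  iseqv := ⟨Der.refl, Der.symm, Der.trans⟩

/-- Classes `[t]_E` of terms modulo provable equality in `E`. -/
def Cls (E : Presentation.{u}) (Θ : List ℕ) (n : ℕ) : Type u := Quotient (derSetoid E Θ n)

/-- The class of a term. -/
def Cls.mk {E : Presentation.{u}} {Θ : List ℕ} {n : ℕ} (t : Tm E.sig Θ n) : Cls E Θ n :=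
  Quotient.mk (derSetoid E Θ n) t

theorem Cls.mk_eq {E : Presentation.{u}} {Θ : List ℕ} {n : ℕ} {s t : Tm E.sig Θ n} :
    (Cls.mk s : Cls E Θ n) = Cls.mk t ↔ Der E s t :=
  Quotient.eq (r := derSetoid E Θ n)

/-- A chosen representative of a class. -/
noncomputable def Cls.rep {E : Presentation.{u}} {Θ : List ℕ} {n : ℕ} (c : Cls E Θ n) :
    Tm E.sig Θ n := Quotient.out c

@[simp] theorem Cls.mk_rep {E : Presentation.{u}} {Θ : List ℕ} {n : ℕ} (c : Cls E Θ n) :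
    Cls.mk c.rep = c := Quotient.out_eq c

theorem Cls.rep_mk {E : Presentation.{u}} {Θ : List ℕ} {n : ℕ} (t : Tm E.sig Θ n) :
    Der E (Cls.mk t : Cls E Θ n).rep t := Cls.mk_eq.1 (Cls.mk_rep _)

/-! ### Tuples of terms -/

/-- Tuples `⟨Θ ▷ x₁, …, x_{nᵢ} ⊢ tᵢ⟩ᵢ` of terms, indexed by `Ξ = (n₁, …, nₗ)`. -/
abbrev Tuple (S : Sig.{u}) (Θ Ξ : List ℕ) : Type u := ∀ m : ℕ, Pos Ξ m → Tm S Θ m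

namespace Tuple

variable {S : Sig.{u}} {Θ Ξ Ψ Φ : List ℕ}

/-- `t{𝗆ᵢ := (xᵢ) sᵢ}` with closed abstractions -/
def inst (s : Tuple S Θ Ξ) {n : ℕ} (t : Tm S Ξ n) : Tm S Θ n :=
  Tm.msubst (fun m p => rename (Fin.natAdd n) (s m p)) t

/-- The tuple `⟨𝗆ᵢ[x₁, …, x_{mᵢ}]⟩ᵢ`. -/
def id (Θ : List ℕ) : Tuple S Θ Θ := fun _ p => .mvar p .var

/-- Composition of tuples by metasubstitution. -/
def comp (s : Tuple S Θ Ξ) (t : Tuple S Ξ Ψ) : Tuple S Θ Ψ := fun m p => s.inst (t m p)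

theorem inst_mvar (s : Tuple S Θ Ξ) {n m : ℕ} (p : Pos Ξ m) (ts : Fin m → Tm S Ξ n) :
    s.inst (.mvar p ts) = subst (fun j => s.inst (ts j)) (s m p) := by
  simp [inst, Tm.msubst, subst_rename]

theorem inst_inst (s : Tuple S Θ Ξ) (t : Tuple S Ξ Ψ) {n : ℕ} (r : Tm S Ψ n) :
    s.inst (t.inst r) = (s.comp t).inst r := by
  simp only [inst, comp, msubst_eq, ginst_ginst, ginst_rename, rename_ginst]
  congr 1
  funext m p
  congr 1
  · funext i; simp [Tm.rename]
  · funext k q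
    simp only [wk, rename_rename]
    congr 1
    funext i
    simp

theorem id_inst {n : ℕ} (t : Tm S Θ n) : (Tuple.id Θ).inst t = t := by
  simp only [inst, msubst_eq]
  conv_rhs => rw [← ginst_mid t]
  rfl

theorem comp_id (s : Tuple S Θ Ξ) : s.comp (Tuple.id Ξ) = s := by
  funext m p
  simp only [comp, id, inst_mvar]
  exact subst_var _

theorem id_comp (s : Tuple S Θ Ξ) : (Tuple.id Θ).comp s = s := by
  funext m p
  exact id_inst _

theorem assoc (s : Tuple S Θ Ξ) (t : Tuple S Ξ Ψ) (r : Tuple S Ψ Φ) :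
    (s.comp t).comp r = s.comp (t.comp r) := by
  funext m p
  exact (inst_inst _ _ _).symm

end Tuple

theorem Der.inst {E : Presentation.{u}} {Θ Ξ : List ℕ} {n : ℕ} {s t : Tm E.sig Ξ n}
    (h : Der E s t) {f g : Tuple E.sig Θ Ξ} (hf : ∀ m p, Der E (f m p) (g m p)) :
    Der E (f.inst s) (g.inst t) := by
  simp only [Tuple.inst, msubst_eq]
  exact h.ginst (fun _ => .refl _) (fun m p => (hf m p).rename _)

/-! ### The second-order theory of equality `𝕄` and second-order algebraic theories -/

/-- Objects of `𝕄`: finite sequences of natural numbers. -/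
structure MObj : Type where
  ctx : List ℕ

/-- The category `𝕄`: its morphisms `(m₁, …, mₖ) ⟶ (n₁, …, nₗ)` are tuples of elementary terms. -/
instance MObj.category : Category.{0} MObj where
  Hom Θ Ξ := Tuple Sig.empty Θ.ctx Ξ.ctx
  id Θ := Tuple.id Θ.ctx
  comp s t := Tuple.comp s t
  id_comp := Tuple.id_comp
  comp_id := Tuple.comp_id
  assoc := Tuple.assoc

/-- The morphisms of `𝕄`. -/
abbrev ElemTuple (Θ Ξ : List ℕ) : Type := Tuple Sig.empty Θ Ξ

namespace ElemTuple

/-- First projection of the product `Θ × Ξ = Θ ++ Ξ` of `𝕄`. -/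
def fst (Θ Ξ : List ℕ) : ElemTuple (Θ ++ Ξ) Θ := fun _ p => .mvar p.inl .var

/-- Second projection of the product `Θ × Ξ = Θ ++ Ξ` of `𝕄`. -/
def snd (Θ Ξ : List ℕ) : ElemTuple (Θ ++ Ξ) Ξ := fun _ p => .mvar (p.inr Θ) .var

/-- The projection `(m₁, …, mₖ) ⟶ (mᵢ)` of `𝕄`, given by `𝗆ᵢ[x₁, …, x_{mᵢ}]`. -/
def proj (Θ : List ℕ) {m : ℕ} (p : Pos Θ m) : ElemTuple Θ [m] :=
  Pos.single (F := ElemTm Θ) (.mvar p .var)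

/-- The evaluation map `((0) ⇒ Θ) × (0) ⟶ Θ` of `𝕄`, where `(0) ⇒ (m₁, …, mₖ)` is
`(m₁ + 1, …, mₖ + 1)`; its components are `𝗆ᵢ[x₁, …, x_{mᵢ}, 𝗇[]]`. -/
def ev (Θ : List ℕ) : ElemTuple (Θ.map (· + 1) ++ [0]) Θ := fun m p =>
  .mvar p.up.inl (Fin.addCases (m := m) (n := 1) .var (fun _ => .mvar (Pos.inr _ .head) Fin.elim0))

end ElemTuple

/-- A small category with the same objects as `𝕄`, together with an identity-on-objects functor
from `𝕄`; `map` is the action of that functor on morphisms. -/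
structure TheoryData : Type (u + 1) where
  Hom : List ℕ → List ℕ → Type u
  id (X : List ℕ) : Hom X X
  comp {X Y Z : List ℕ} (f : Hom X Y) (g : Hom Y Z) : Hom X Z
  id_comp {X Y : List ℕ} (f : Hom X Y) : comp (id X) f = f
  comp_id {X Y : List ℕ} (f : Hom X Y) : comp f (id Y) = f
  assoc {X Y Z W : List ℕ} (f : Hom X Y) (g : Hom Y Z) (h : Hom Z W) :
    comp (comp f g) h = comp f (comp g h)
  map {X Y : List ℕ} (s : ElemTuple X Y) : Hom X Y
  map_id (X : List ℕ) : map (Tuple.id X) = id X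
  map_comp {X Y Z : List ℕ} (s : ElemTuple X Y) (t : ElemTuple Y Z) :
    map (s.comp t) = comp (map s) (map t)

namespace TheoryData

/-- The objects of the category. -/
structure Obj (T : TheoryData.{u}) : Type where
  ctx : List ℕ

/-- The category, as a Mathlib category. -/
instance category (T : TheoryData.{u}) : Category.{u} T.Obj where
  Hom X Y := T.Hom X.ctx Y.ctx
  id X := T.id X.ctx
  comp f g := T.comp f g
  id_comp := T.id_comp
  comp_id := T.comp_id
  assoc := T.assoc

/-- A sequence as an object. -/
abbrev ob (T : TheoryData.{u}) (X : List ℕ) : T.Obj := ⟨X⟩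

/-- A morphism as an arrow of the Mathlib category. -/
def arr (T : TheoryData.{u}) {X Y : List ℕ} (f : T.Hom X Y) : T.ob X ⟶ T.ob Y := f

/-- The identity-on-objects functor from `𝕄`. -/
def incl (T : TheoryData.{u}) : MObj ⥤ T.Obj where
  obj X := ⟨X.ctx⟩
  map s := T.map s
  map_id X := T.map_id X.ctx
  map_comp s t := T.map_comp s t

end TheoryData

/-- Second-order algebraic theories: identity-on-objects functors `M` from `𝕄` to a small cartesian
category that are strict cartesian (the terminal object, the binary products and their projections
are the images under `M` of those of `𝕄`) and preserve the exponentiable object `(0)`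
(the image under `M` of the evaluation map of each exponential `(0) ⇒ Y` of `𝕄` is universal: each
`f : X × (0) ⟶ Y` is `M ev ∘ (g × (0))` for a unique mate `g : X ⟶ ((0) ⇒ Y)`; below, `h` is
the map `g × (0)`, characterised by its two projections). -/
structure SOAT : Type (u + 1) extends TheoryData.{u} where
  terminal : Nonempty (IsTerminal (toTheoryData.ob []))
  product (X Y : List ℕ) : Nonempty (IsLimit (BinaryFan.mk
    (toTheoryData.arr (map (ElemTuple.fst X Y))) (toTheoryData.arr (map (ElemTuple.snd X Y)))))
  exponential (X Y : List ℕ) (f : Hom (X ++ [0]) Y) :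
    ∃! g : Hom X (Y.map (· + 1)), ∃ h : Hom (X ++ [0]) (Y.map (· + 1) ++ [0]),
      comp h (map (ElemTuple.fst _ _)) = comp (map (ElemTuple.fst _ _)) g ∧
      comp h (map (ElemTuple.snd _ _)) = map (ElemTuple.snd _ _) ∧
      comp h (map (ElemTuple.ev Y)) = f

/-! ### Algebraic translations -/

/-- Algebraic translations: cartesian functors that commute with the functors from `𝕄`. -/
@[ext]
structure Translation (T T₂ : SOAT.{u}) : Type u where
  F : T.Obj ⥤ T₂.Obj
  cartesian : PreservesFiniteProducts F
  comm : T.incl ⋙ F = T₂.incl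

/-- The category of second-order algebraic theories and algebraic translations. -/
instance SOAT.category : Category.{u} SOAT.{u} where
  Hom := Translation
  id T := ⟨𝟭 _, inferInstance, rfl⟩
  comp F G := ⟨F.F ⋙ G.F, by
    have := F.cartesian; have := G.cartesian; infer_instance, by
    rw [← Functor.assoc, F.comm, G.comm]⟩

namespace Translation

variable {T T₂ T₃ : SOAT.{u}}

theorem obj_eq (F : Translation T T₂) (X : List ℕ) : F.F.obj (T.ob X) = T₂.ob X :=
  Functor.congr_obj F.comm (⟨X⟩ : MObj)

/-- The action of an algebraic translation on morphisms. Since it commutes with the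
identity-on-objects functors from `𝕄`, it is the identity on objects (`obj_eq`), so it sends
morphisms `X ⟶ Y` to morphisms `X ⟶ Y`. -/
def hom (F : Translation T T₂) {X Y : List ℕ} (f : T.Hom X Y) : T₂.Hom X Y :=
  eqToHom (F.obj_eq X).symm ≫ F.F.map (T.arr f) ≫ eqToHom (F.obj_eq Y)

theorem arr_hom (F : Translation T T₂) {X Y : List ℕ} (f : T.Hom X Y) :
    T₂.arr (F.hom f) = eqToHom (F.obj_eq X).symm ≫ F.F.map (T.arr f) ≫ eqToHom (F.obj_eq Y) :=
  rfl

theorem hom_id (F : Translation T T₂) (X : List ℕ) : F.hom (T.id X) = T₂.id X := by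
  change T₂.arr (F.hom (T.id X)) = 𝟙 (T₂.ob X)
  have h : T.arr (T.id X) = 𝟙 (T.ob X) := rfl
  rw [arr_hom, h]
  simp

theorem hom_comp (F : Translation T T₂) {X Y Z : List ℕ} (f : T.Hom X Y) (g : T.Hom Y Z) :
    F.hom (T.comp f g) = T₂.comp (F.hom f) (F.hom g) := by
  change T₂.arr (F.hom (T.comp f g)) = T₂.arr (F.hom f) ≫ T₂.arr (F.hom g)
  have h : T.arr (T.comp f g) = T.arr f ≫ T.arr g := rfl
  rw [arr_hom, arr_hom, arr_hom, h]
  simp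

theorem hom_map (F : Translation T T₂) {X Y : List ℕ} (s : ElemTuple X Y) :
    F.hom (T.map s) = T₂.map s := by
  have h : F.F.map (T.arr (T.map s)) = eqToHom (F.obj_eq X) ≫ T₂.arr (T₂.map s) ≫
    eqToHom (F.obj_eq Y).symm :=
    Functor.congr_hom F.comm (X := (⟨X⟩ : MObj)) (Y := (⟨Y⟩ : MObj)) s
  change T₂.arr (F.hom (T.map s)) = T₂.arr (T₂.map s)
  rw [arr_hom, h]
  simp

theorem ext_hom {F G : Translation T T₂}
    (h : ∀ (X Y : List ℕ) (f : T.Hom X Y), F.hom f = G.hom f) : F = G := by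
  refine Translation.ext (CategoryTheory.Functor.ext
    (fun X => (F.obj_eq X.ctx).trans (G.obj_eq X.ctx).symm) fun X Y f => ?_)
  have e₁ : T₂.arr (F.hom f) = T₂.arr (G.hom f) := h X.ctx Y.ctx f
  rw [arr_hom, arr_hom] at e₁
  have e₂ : ∀ H : Translation T T₂, H.F.map f = eqToHom (H.obj_eq X.ctx) ≫
      (eqToHom (H.obj_eq X.ctx).symm ≫ H.F.map (T.arr (X := X.ctx) (Y := Y.ctx) f) ≫
        eqToHom (H.obj_eq Y.ctx)) ≫ eqToHom (H.obj_eq Y.ctx).symm := by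
    intro H
    simp
    rfl
  rw [e₂ F, e₁, e₂ G]
  simp

theorem isLimit_eqToHom {C : Type v} [Category.{w} C] {P Q A A₂ B B₂ : C} (f : P ⟶ A) (g : P ⟶ B)
    (h : Nonempty (IsLimit (BinaryFan.mk f g))) (hP : Q = P) (hA : A = A₂) (hB : B = B₂) :
    Nonempty (IsLimit (BinaryFan.mk (eqToHom hP ≫ f ≫ eqToHom hA)
      (eqToHom hP ≫ g ≫ eqToHom hB))) := by
  subst hP hA hB
  simpa using h

/-- Functors that commute with the functors from `𝕄` are cartesian. -/
theorem preserves (F : T.Obj ⥤ T₂.Obj) (comm : T.incl ⋙ F = T₂.incl) :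
    PreservesFiniteProducts F := by
  have hobj : ∀ X : List ℕ, F.obj (T.ob X) = T₂.ob X := fun X =>
    Functor.congr_obj comm (⟨X⟩ : MObj)
  have hmap : ∀ {X Y : List ℕ} (s : ElemTuple X Y), F.map (T.arr (T.map s)) =
      eqToHom (hobj X) ≫ T₂.arr (T₂.map s) ≫ eqToHom (hobj Y).symm := fun {X Y} s =>
    Functor.congr_hom comm (X := (⟨X⟩ : MObj)) (Y := (⟨Y⟩ : MObj)) s
  obtain ⟨t⟩ := T.terminal
  obtain ⟨t₂⟩ := T₂.terminal
  have : HasTerminal T.Obj := t.hasTerminal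
  have h₁ : ∀ X Y : T.Obj, HasLimit (pair X Y) := fun X Y =>
    let ⟨l⟩ := T.product X.ctx Y.ctx
    ⟨⟨⟨_, l⟩⟩⟩
  have : HasBinaryProducts T.Obj := hasBinaryProducts_of_hasLimit_pair _
  have : HasFiniteProducts T.Obj := hasFiniteProducts_of_has_binary_and_terminal
  have h₂ : ∀ X Y : T.Obj, PreservesLimit (pair X Y) F := fun X Y => by
    obtain ⟨l⟩ := T.product X.ctx Y.ctx
    refine preservesLimit_of_preserves_limit_cone l
      ((isLimitMapConeBinaryFanEquiv F _ _).symm (Nonempty.some ?_))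
    rw [hmap, hmap]
    exact isLimit_eqToHom _ _ (T₂.product X.ctx Y.ctx) _ _ _
  have : PreservesLimitsOfShape (Discrete WalkingPair) F :=
    ⟨fun {K} => preservesLimit_of_iso_diagram F (diagramIsoPair K).symm⟩
  have : PreservesLimit (Functor.empty.{0} T.Obj) F := by
    refine preservesLimit_of_preserves_limit_cone t
      ((isLimitMapConeEmptyConeEquiv F _).symm ?_)
    rw [hobj]
    exact t₂
  have : PreservesLimitsOfShape (Discrete PEmpty.{1}) F :=
    preservesLimitsOfShape_pempty_of_preservesTerminal F
  exact .of_preserves_binary_and_terminal F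

/-- The algebraic translation with a given action on morphisms. -/
def ofMap (φ : ∀ {X Y : List ℕ}, T.Hom X Y → T₂.Hom X Y) (id : ∀ X, φ (T.id X) = T₂.id X)
    (comp : ∀ {X Y Z : List ℕ} (f : T.Hom X Y) (g : T.Hom Y Z),
      φ (T.comp f g) = T₂.comp (φ f) (φ g))
    (map : ∀ {X Y : List ℕ} (s : ElemTuple X Y), φ (T.map s) = T₂.map s) : Translation T T₂ :=
  have h : T.incl ⋙ (⟨fun X => ⟨X.ctx⟩, fun f => φ f, fun X => id X.ctx, fun f g => comp f g⟩ :
      T.Obj ⥤ T₂.Obj) = T₂.incl := by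
    refine CategoryTheory.Functor.ext (fun X => rfl) fun X Y s => ?_
    change _ = 𝟙 (T₂.ob X.ctx) ≫ T₂.arr (T₂.map s) ≫ 𝟙 (T₂.ob Y.ctx)
    rw [Category.id_comp, Category.comp_id]
    exact map s
  { F := ⟨fun X => ⟨X.ctx⟩, fun f => φ f, fun X => id X.ctx, fun f g => comp f g⟩
    cartesian := preserves _ h
    comm := h }

theorem ofMap_hom (φ : ∀ {X Y : List ℕ}, T.Hom X Y → T₂.Hom X Y) (id comp map)
    {X Y : List ℕ} (f : T.Hom X Y) : (ofMap (T := T) (T₂ := T₂) φ id comp map).hom f = φ f := by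
  change 𝟙 (T₂.ob X) ≫ T₂.arr (φ f) ≫ 𝟙 (T₂.ob Y) = T₂.arr (φ f)
  rw [Category.id_comp, Category.comp_id]

theorem id_hom {X Y : List ℕ} (f : T.Hom X Y) : Translation.hom (𝟙 T) f = f := by
  change 𝟙 (T.ob X) ≫ T.arr f ≫ 𝟙 (T.ob Y) = T.arr f
  rw [Category.id_comp, Category.comp_id]

theorem comp_hom (F : T ⟶ T₂) (G : T₂ ⟶ T₃) {X Y : List ℕ} (f : T.Hom X Y) :
    Translation.hom (F ≫ G) f = Translation.hom G (Translation.hom F f) := by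
  change T₃.arr (Translation.hom (F ≫ G) f) = T₃.arr (Translation.hom G (Translation.hom F f))
  rw [arr_hom, arr_hom, arr_hom]
  change eqToHom _ ≫ G.F.map (F.F.map (T.arr f)) ≫ eqToHom _ = _
  simp [eqToHom_map]

end Translation

/-! ### The theory of a presentation -/

namespace Presentation

/-- The classifying category of a presentation: morphisms are tuples of classes of terms modulo
provable equality; identities and composition are given on representatives as in `𝕄`
(see `comp_mk`), and `map` sends a tuple of elementary terms to the tuple of their classes. -/
noncomputable def theoryData (E : Presentation.{u}) : TheoryData.{u} where
  Hom X Y := ∀ m : ℕ, Pos Y m → Cls E X m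
  id X := fun m p => Cls.mk (Tuple.id X m p)
  comp f g := fun m p => Cls.mk (Tuple.inst (fun k q => (f k q).rep) (g m p).rep)
  id_comp f := by
    funext m p
    rw [← Cls.mk_rep (f m p), Cls.mk_eq]
    refine ((Cls.rep_mk _).inst (fun k q => Cls.rep_mk _)).trans ?_
    rw [Tuple.id_inst]
    exact Der.refl _
  comp_id f := by
    funext m p
    conv_rhs => rw [← Cls.mk_rep (f m p)]
    rw [Cls.mk_eq]
    refine ((Cls.rep_mk _).inst (fun k q => Der.refl _)).trans ?_
    change Der E ((Tuple.comp (fun k q => (f k q).rep) (Tuple.id _)) m p) _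
    rw [Tuple.comp_id]
    exact Der.refl _
  assoc f g h := by
    funext m p
    rw [Cls.mk_eq]
    refine ((Der.refl _).inst (fun k q => Cls.rep_mk _)).trans
      (Der.trans ?_ ((Cls.rep_mk _).inst (fun k q => Der.refl _)).symm)
    rw [Tuple.inst_inst]
    exact Der.refl _
  map s := fun m p => Cls.mk (Tm.ofElem (s m p))
  map_id X := rfl
  map_comp s t := by
    funext m p
    rw [Cls.mk_eq]
    refine Der.trans ?_ ((Cls.rep_mk _).inst (fun k q => Cls.rep_mk _)).symm
    simp only [Tuple.comp, Tuple.inst, ofElem, translate_msubst, translate_rename]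
    exact Der.refl _

theorem comp_mk (E : Presentation.{u}) {X Y Z : List ℕ} (s : Tuple E.sig X Y)
    (t : Tuple E.sig Y Z) : E.theoryData.comp (X := X) (Y := Y) (Z := Z)
      (fun m p => Cls.mk (s m p)) (fun m p => Cls.mk (t m p)) =
      fun m p => Cls.mk (s.comp t m p) := by
  funext m p
  exact Cls.mk_eq.2 ((Cls.rep_mk _).inst (fun k q => Cls.rep_mk _))

theorem hom_ind (E : Presentation.{u}) {X Y : List ℕ} {P : E.theoryData.Hom X Y → Prop}
    (h : ∀ s : Tuple E.sig X Y, P (fun m p => Cls.mk (s m p))) (f : E.theoryData.Hom X Y) :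
    P f := by
  have := h (fun m p => (f m p).rep)
  simpa using this

end Presentation

namespace Presentation

variable (E : Presentation.{u})

/-- Tuples of classes of terms. -/
abbrev ClsTuple (X Y : List ℕ) : Type u := ∀ m : ℕ, Pos Y m → Cls E X m

theorem comp_mvar {X Y Z : List ℕ} (f : E.ClsTuple X Y) (ρ : ∀ m : ℕ, Pos Z m → Pos Y m) :
    E.theoryData.comp (Z := Z) f (fun m p => Cls.mk (.mvar (ρ m p) .var)) =
      fun m p => f m (ρ m p) := by
  revert f
  refine E.hom_ind fun s => ?_
  rw [E.comp_mk s (fun m p => .mvar (ρ m p) .var)]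
  funext m p
  simp only [Tuple.comp, Tuple.inst_mvar]
  exact congrArg Cls.mk (subst_var _)

/-- Exponential mate: the metavariable of arity `0` that comes last is replaced by a new variable. -/
def mate {S : Sig.{u}} {X : List ℕ} {m : ℕ} (t : Tm S (X ++ [0]) m) : Tm S X (m + 1) :=
  Tm.ginst (fun i => .var (Fin.castAdd 1 i))
    (Pos.app (F := fun k => Tm S X (m + 1 + k)) X Tm.mid
      (Pos.single (F := fun k => Tm S X (m + 1 + k)) (.var (Fin.natAdd m 0)))) t

/-- Inverse of `mate`. -/
def unmate {S : Sig.{u}} {X : List ℕ} {m : ℕ} (t : Tm S X (m + 1)) : Tm S (X ++ [0]) m :=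
  Tm.ginst (Fin.addCases (m := m) (n := 1) .var (fun _ => .mvar (Pos.inr X .head) Fin.elim0))
    (fun _ p => .mvar p.inl (fun j => .var (Fin.natAdd m j))) t

theorem unmate_mate {S : Sig.{u}} {X : List ℕ} {m : ℕ} (t : Tm S (X ++ [0]) m) :
    unmate (mate t) = t := by
  unfold unmate mate
  rw [ginst_ginst]
  conv_rhs => rw [← ginst_mid t]
  congr 1
  · funext i
    simp [Tm.ginst]
  · funext k p
    refine Pos.app_ind (P := fun k p => Tm.ginst (liftS k _) (wk k _) (Pos.app X Tm.mid _ k p) =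
      (Tm.mid k p : Tm S (X ++ [0]) (m + k))) (fun k p => ?_) (fun k p => ?_) k p
    · rw [Pos.app_inl]
      simp [Tm.ginst, Tm.mid, wk, Tm.rename, Tm.subst]
    · rw [Pos.app_inr]
      cases p with
      | head =>
        simp only [Pos.single, Tm.ginst]
        change liftS 0 _ (Fin.castAdd 0 (Fin.natAdd m 0)) = _
        rw [liftS_castAdd, Fin.addCases_right]
        simp only [Tm.rename, Tm.mid]
        congr 1
        funext i
        exact i.elim0
      | tail p => cases p

theorem mate_unmate {S : Sig.{u}} {X : List ℕ} {m : ℕ} (t : Tm S X (m + 1)) :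
    mate (unmate t) = t := by
  unfold unmate mate
  rw [ginst_ginst]
  conv_rhs => rw [← ginst_mid t]
  congr 1
  · refine fin_ext (fun i => ?_) (fun i => ?_)
    · rw [Fin.addCases_left]
      rfl
    · rw [Fin.addCases_right]
      simp only [Tm.ginst]
      rw [Pos.app_inr]
      have e : (Pos.single (F := fun k => Tm S X (m + 1 + k)) (.var (Fin.natAdd m 0)) 0 .head :
          Tm S X (m + 1 + 0)) = .var (Fin.castAdd 0 (Fin.natAdd m (0 : Fin 1))) := rfl
      rw [e, Tm.subst, Fin.addCases_left, Subsingleton.elim i 0]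
  · funext k p
    simp only [Tm.ginst, wk, Pos.app_inl, Tm.mid, Tm.rename, Tm.subst]
    simp

theorem der_mate {X : List ℕ} {m : ℕ} {s t : Tm E.sig (X ++ [0]) m} (h : Der E s t) :
    Der E (mate s) (mate t) := h.ginst (fun _ => .refl _) (fun _ _ => .refl _)

theorem der_unmate {X : List ℕ} {m : ℕ} {s t : Tm E.sig X (m + 1)} (h : Der E s t) :
    Der E (unmate s) (unmate t) := h.ginst (fun _ => .refl _) (fun _ _ => .refl _)

theorem comp_ev {X Y : List ℕ} (g : E.ClsTuple X (Y.map (· + 1)))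
    (h : E.ClsTuple (X ++ [0]) (Y.map (· + 1) ++ [0]))
    (h₁ : E.theoryData.comp h (E.theoryData.map (ElemTuple.fst _ _)) =
      E.theoryData.comp (E.theoryData.map (ElemTuple.fst _ _)) g)
    (h₂ : E.theoryData.comp h (E.theoryData.map (ElemTuple.snd _ _)) =
      E.theoryData.map (ElemTuple.snd _ _)) :
    E.theoryData.comp h (E.theoryData.map (ElemTuple.ev Y)) =
      fun m p => Cls.mk (unmate (g (m + 1) p.up).rep) := by
  funext m p
  have e₁ : h (m + 1) p.up.inl =
      Cls.mk (Tuple.inst (fun _ q => .mvar q.inl .var) (g (m + 1) p.up).rep) := by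
    have := (E.comp_mvar h (fun _ q => q.inl)).symm.trans h₁
    have := congrFun (congrFun this (m + 1)) p.up
    rw [this]
    exact Cls.mk_eq.2 ((Der.refl _).inst fun _ _ => Cls.rep_mk _)
  have e₂ : h 0 (Pos.inr _ .head) = Cls.mk (.mvar (Pos.inr X .head) .var) :=
    congrFun (congrFun ((E.comp_mvar h (fun _ q => Pos.inr _ q)).symm.trans h₂) 0) .head
  have d₁ : Der E (h (m + 1) p.up.inl).rep
      (Tuple.inst (fun _ q => .mvar q.inl .var) (g (m + 1) p.up).rep) :=
    Cls.mk_eq.1 (by rw [Cls.mk_rep, e₁])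
  have d₂ : Der E (h 0 (Pos.inr _ .head)).rep (.mvar (Pos.inr X .head) .var) :=
    Cls.mk_eq.1 (by rw [Cls.mk_rep, e₂])
  refine Cls.mk_eq.2 (((Cls.rep_mk _).inst fun _ _ => .refl _).trans ?_)
  have e₃ : (Tm.ofElem (ElemTuple.ev Y m p) : Tm E.sig (Y.map (· + 1) ++ [0]) m) =
      .mvar p.up.inl (fun j => Tm.ofElem (Fin.addCases (m := m) (n := 1) .var
        (fun _ => .mvar (Pos.inr _ .head) Fin.elim0) j)) := rfl
  rw [e₃, Tuple.inst_mvar]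
  have e₄ : unmate (g (m + 1) p.up).rep = Tm.subst (Fin.addCases (m := m) (n := 1) .var
      (fun _ => .mvar (Pos.inr X .head) Fin.elim0))
      (Tuple.inst (fun _ q => .mvar q.inl .var) (g (m + 1) p.up).rep) := by
    simp only [unmate, Tuple.inst, msubst_eq, subst_ginst, Tm.rename, Tm.subst]
    congr 1
    funext k q
    congr 1
    funext j
    exact (liftS_natAdd k _ j).symm
  rw [e₄]
  refine d₁.subst (fun j => ?_)
  refine Fin.addCases (fun i => ?_) (fun i => ?_) j
  · rw [Fin.addCases_left, Fin.addCases_left]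
    exact Der.refl _
  · rw [Fin.addCases_right, Fin.addCases_right]
    have e₅ : (Tm.ofElem (.mvar (Pos.inr (Y.map (· + 1)) .head) Fin.elim0) :
        Tm E.sig (Y.map (· + 1) ++ [0]) m) =
      .mvar (Pos.inr (Y.map (· + 1)) .head) Fin.elim0 :=
      congrArg (Tm.mvar _) (funext fun i => i.elim0)
    rw [e₅, Tuple.inst_mvar]
    refine (d₂.subst (fun _ => .refl _)).trans ?_
    have e₆ : ∀ (θ : Fin 0 → Tm E.sig (X ++ [0]) m),
        Tm.subst θ (.mvar (Pos.inr X .head) .var) = .mvar (Pos.inr X .head) Fin.elim0 :=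
      fun θ => congrArg (Tm.mvar _) (funext fun i => i.elim0)
    rw [e₆]
    exact Der.refl _

theorem pair_eq {X Y Z : List ℕ} (f : E.ClsTuple Z X) (g : E.ClsTuple Z Y)
    (l : E.ClsTuple Z (X ++ Y)) (h₁ : (fun m p => l m p.inl) = f)
    (h₂ : (fun m p => l m (Pos.inr X p)) = g) : l = Pos.app (F := fun m => Cls E Z m) X f g := by
  funext m p
  refine Pos.app_ind (P := fun m p => l m p = Pos.app (F := fun m => Cls E Z m) X f g m p)
    (fun m p => ?_) (fun m p => ?_) m p
  · rw [Pos.app_inl, ← h₁]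
  · rw [Pos.app_inr, ← h₂]

theorem exists_mate {X Y : List ℕ} (f : E.ClsTuple (X ++ [0]) Y) :
    ∃! g : E.ClsTuple X (Y.map (· + 1)), ∃ h : E.ClsTuple (X ++ [0]) (Y.map (· + 1) ++ [0]),
      E.theoryData.comp h (E.theoryData.map (ElemTuple.fst _ _)) =
        E.theoryData.comp (E.theoryData.map (ElemTuple.fst _ _)) g ∧
      E.theoryData.comp h (E.theoryData.map (ElemTuple.snd _ _)) =
        E.theoryData.map (ElemTuple.snd _ _) ∧
      E.theoryData.comp h (E.theoryData.map (ElemTuple.ev Y)) = f := by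
  refine ⟨Pos.ups (F := fun m => Cls E X m) fun m p => Cls.mk (mate (f m p).rep), ?_, ?_⟩
  · have key : ∀ (a : E.ClsTuple (X ++ [0]) (Y.map (· + 1))) (b : E.ClsTuple (X ++ [0]) [0]),
        ∃ h : E.ClsTuple (X ++ [0]) (Y.map (· + 1) ++ [0]),
        E.theoryData.comp h (E.theoryData.map (ElemTuple.fst _ _)) = a ∧
        E.theoryData.comp h (E.theoryData.map (ElemTuple.snd _ _)) = b := fun a b =>
      ⟨Pos.app (F := fun m => Cls E (X ++ [0]) m) _ a b,
        (E.comp_mvar _ (fun _ p => p.inl)).trans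
          (funext fun m => funext fun p => Pos.app_inl a b p),
        (E.comp_mvar _ (fun _ p => Pos.inr _ p)).trans
          (funext fun m => funext fun p => Pos.app_inr a b p)⟩
    obtain ⟨h, h₁, h₂⟩ := key (E.theoryData.comp (E.theoryData.map (ElemTuple.fst X [0]))
      (Pos.ups (F := fun m => Cls E X m) fun m p => Cls.mk (mate (f m p).rep)))
      (E.theoryData.map (ElemTuple.snd X [0]))
    refine ⟨h, h₁, h₂, (E.comp_ev _ _ h₁ h₂).trans ?_⟩
    funext m p
    rw [Pos.ups_up]
    conv_rhs => rw [← Cls.mk_rep (f m p)]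
    rw [Cls.mk_eq]
    refine (E.der_unmate (Cls.rep_mk _)).trans ?_
    rw [unmate_mate]
    exact Der.refl _
  · rintro g ⟨h, h₁, h₂, h₃⟩
    have h₃ : (fun m p => Cls.mk (unmate (g (m + 1) p.up).rep)) = f :=
      (E.comp_ev g h h₁ h₂).symm.trans h₃
    funext m p
    refine Pos.ups_ind (P := fun m p => g m p = Pos.ups (F := fun m => Cls E X m)
      (fun m p => Cls.mk (mate (f m p).rep)) m p) (fun m p => ?_) m p
    rw [Pos.ups_up, ← h₃]
    conv_lhs => rw [← Cls.mk_rep (g (m + 1) p.up)]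
    rw [Cls.mk_eq]
    refine Der.trans ?_ (E.der_mate (Cls.rep_mk _)).symm
    rw [mate_unmate]
    exact Der.refl _

/-- The second-order algebraic theory of a presentation. -/
noncomputable def theory : SOAT.{u} where
  toTheoryData := E.theoryData
  terminal := ⟨IsTerminal.ofUniqueHom (fun X => E.theoryData.arr (Y := []) fun m p => nomatch p)
    (fun X f => funext fun m => funext fun p => nomatch p)⟩
  product X Y := ⟨BinaryFan.isLimitMk
    (fun s m p => Pos.app (F := fun m => Cls E s.pt.ctx m) X s.fst s.snd m p)
    (fun s => (E.comp_mvar (Z := X) _ (fun _ p => p.inl)).trans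
      (funext fun m => funext fun p => Pos.app_inl _ _ p))
    (fun s => (E.comp_mvar (Z := Y) _ (fun _ p => Pos.inr X p)).trans
      (funext fun m => funext fun p => Pos.app_inr _ _ p))
    (fun s l h₁ h₂ => E.pair_eq (Z := s.pt.ctx) s.fst s.snd l
      ((E.comp_mvar (Z := X) l (fun _ p => p.inl)).symm.trans h₁)
      ((E.comp_mvar (Z := Y) l (fun _ p => Pos.inr X p)).symm.trans h₂))⟩
  exponential _ _ f := E.exists_mate f

end Presentation

/-! ### Syntactic translations -/

/-- Syntactic translations: each operator `ω : (m₁, …, mₖ)` is sent to a term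
`𝗆₁ : [m₁], …, 𝗆ₖ : [mₖ] ▷ · ⊢ τ ω`, and the basic equations of `E` are sent to equations
derivable in `E₂`. -/
structure SynTrans (E E₂ : Presentation.{u}) : Type u where
  toTm (ω : E.sig.Op) : Tm E₂.sig (E.sig.arity ω) 0
  sound {Θ : List ℕ} {n : ℕ} {s t : Tm E.sig Θ n} (h : E.Ax s t) :
    Der E₂ (translate toTm s) (translate toTm t)

namespace SynTrans

variable {E E₂ E₃ : Presentation.{u}}

theorem der (τ : SynTrans E E₂) {Θ : List ℕ} {n : ℕ} {s t : Tm E.sig Θ n} (h : Der E s t) :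
    Der E₂ (translate τ.toTm s) (translate τ.toTm t) := by
  induction h with
  | ax h => exact τ.sound h
  | refl t => exact .refl _
  | symm _ ih => exact ih.symm
  | trans _ _ ih₁ ih₂ => exact ih₁.trans ih₂
  | msubst _ _ ih₁ ih₂ =>
    simp only [translate_msubst, translate_rename]
    exact Der.msubst ih₁ ih₂

theorem der_congr {τ τ₂ : ∀ ω : E.sig.Op, Tm E₂.sig (E.sig.arity ω) 0}
    (h : ∀ ω, Der E₂ (τ ω) (τ₂ ω)) {Θ : List ℕ} {n : ℕ} (t : Tm E.sig Θ n) :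
    Der E₂ (translate τ t) (translate τ₂ t) := by
  induction t with
  | var x => exact .refl _
  | mvar p ts ih => exact Der.mvar p ih
  | op ω ts ih =>
    rw [translate_op, translate_op]
    exact (h ω).ginst (fun i => i.elim0) ih

/-- The identity translation `ω ↦ ω((x⃗₁) 𝗆₁[x⃗₁], …, (x⃗ₖ) 𝗆ₖ[x⃗ₖ])`. -/
def id (E : Presentation.{u}) : SynTrans E E where
  toTm := gen
  sound h := by
    rw [translate_gen, translate_gen]
    exact .ax h

/-- Composition: `ω` is sent to the translation by `τ₂` of `τ ω`. -/
def comp (τ : SynTrans E E₂) (τ₂ : SynTrans E₂ E₃) : SynTrans E E₃ where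
  toTm ω := translate τ₂.toTm (τ.toTm ω)
  sound h := by
    rw [← translate_translate, ← translate_translate]
    exact τ₂.der (τ.sound h)

/-- Equality of translations into `E₂`: terms of `E₂` are compared up to provable equality. -/
def setoid (E E₂ : Presentation.{u}) : Setoid (SynTrans E E₂) where
  r τ τ₂ := ∀ ω, Der E₂ (τ.toTm ω) (τ₂.toTm ω)
  iseqv := ⟨fun _ _ => .refl _, fun h ω => (h ω).symm, fun h h₂ ω => (h ω).trans (h₂ ω)⟩

end SynTrans

/-- Second-order equational presentations. -/
abbrev SOEP : Type (u + 1) := Presentation.{u}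

/-- Morphisms of presentations: syntactic translations, two translations being identified when
they send each operator to provably equal terms of the target presentation. -/
def SOEP.Hom (E E₂ : SOEP.{u}) : Type u := Quotient (SynTrans.setoid E E₂)

/-- The morphism given by a syntactic translation. -/
def SynTrans.cls {E E₂ : SOEP.{u}} (τ : SynTrans E E₂) : SOEP.Hom E E₂ :=
  Quotient.mk (SynTrans.setoid E E₂) τ

theorem SynTrans.cls_eq {E E₂ : SOEP.{u}} {τ τ₂ : SynTrans E E₂} :
    τ.cls = τ₂.cls ↔ ∀ ω, Der E₂ (τ.toTm ω) (τ₂.toTm ω) :=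
  Quotient.eq (r := SynTrans.setoid E E₂)

theorem SOEP.Hom.ind {E E₂ : SOEP.{u}} {P : SOEP.Hom E E₂ → Prop} (h : ∀ τ : SynTrans E E₂, P τ.cls)
    (f : SOEP.Hom E E₂) : P f := Quotient.ind h f

/-- Composition of morphisms. -/
def SOEP.Hom.comp {E E₂ E₃ : SOEP.{u}} (f : SOEP.Hom E E₂) (g : SOEP.Hom E₂ E₃) : SOEP.Hom E E₃ :=
  Quotient.map₂ (sa := SynTrans.setoid E E₂) (sb := SynTrans.setoid E₂ E₃)
    (sc := SynTrans.setoid E E₃) SynTrans.comp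
    (fun _ _ h τ₂ _ h₂ ω => (τ₂.der (h ω)).trans (SynTrans.der_congr h₂ _)) f g

/-- The category of second-order equational presentations and syntactic translations. -/
instance SOEP.category : Category.{u} SOEP.{u} where
  Hom := SOEP.Hom
  id E := (SynTrans.id E).cls
  comp f g := f.comp g
  id_comp f := SOEP.Hom.ind (P := fun f => SOEP.Hom.comp (SynTrans.id _).cls f = f)
    (fun τ => SynTrans.cls_eq.2 fun ω => by
      change Der _ (translate τ.toTm (gen ω)) _
      rw [translate_gen_op]
      exact .refl _) f
  comp_id f := SOEP.Hom.ind (P := fun f => SOEP.Hom.comp f (SynTrans.id _).cls = f)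
    (fun τ => SynTrans.cls_eq.2 fun ω => by
      change Der _ (translate gen (τ.toTm ω)) _
      rw [translate_gen]
      exact .refl _) f
  assoc f g h := by
    induction f using SOEP.Hom.ind with | h f
    induction g using SOEP.Hom.ind with | h g
    induction h using SOEP.Hom.ind with | h h
    refine SynTrans.cls_eq.2 fun ω => ?_
    change Der _ (translate h.toTm (translate g.toTm (f.toTm ω)))
      (translate (fun ω => translate h.toTm (g.toTm ω)) (f.toTm ω))
    rw [translate_translate]
    exact .refl _

/-- The class of the term to which a morphism sends an operator. -/
def SOEP.Hom.app {E E₂ : SOEP.{u}} (f : SOEP.Hom E E₂) (ω : E.sig.Op) :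
    Cls E₂ (E.sig.arity ω) 0 :=
  Quotient.lift (s := SynTrans.setoid E E₂) (fun τ => Cls.mk (τ.toTm ω))
    (fun _ _ h => Cls.mk_eq.2 (h ω)) f

theorem SOEP.Hom.ext_app {E E₂ : SOEP.{u}} {f g : SOEP.Hom E E₂} (h : ∀ ω, f.app ω = g.app ω) :
    f = g := by
  induction f using SOEP.Hom.ind with | h f
  induction g using SOEP.Hom.ind with | h g
  exact SynTrans.cls_eq.2 fun ω => Cls.mk_eq.1 (h ω)

/-- The action of a morphism on classes of terms. -/
def SOEP.Hom.onCls {E E₂ : SOEP.{u}} (f : SOEP.Hom E E₂) {Θ : List ℕ} {n : ℕ} (c : Cls E Θ n) :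
    Cls E₂ Θ n :=
  Quotient.lift₂ (s₁ := SynTrans.setoid E E₂) (s₂ := derSetoid E Θ n)
    (fun τ t => Cls.mk (translate τ.toTm t))
    (fun _ _ τ₂ _ h h₂ => Cls.mk_eq.2 ((SynTrans.der_congr h _).trans (τ₂.der h₂))) f c

theorem SOEP.Hom.id_onCls {E : SOEP.{u}} {Θ : List ℕ} {n : ℕ} (c : Cls E Θ n) :
    SOEP.Hom.onCls (𝟙 E) c = c := by
  rw [← Cls.mk_rep c]
  exact congrArg Cls.mk (translate_gen _)

theorem SOEP.Hom.comp_onCls {E E₂ E₃ : SOEP.{u}} (f : E ⟶ E₂) (g : E₂ ⟶ E₃) {Θ : List ℕ} {n : ℕ}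
    (c : Cls E Θ n) :
    SOEP.Hom.onCls (f ≫ g) c = SOEP.Hom.onCls g (SOEP.Hom.onCls f c) := by
  rw [← Cls.mk_rep c]
  induction f using SOEP.Hom.ind with | h f
  induction g using SOEP.Hom.ind with | h g
  exact congrArg Cls.mk (translate_translate _ _ _).symm

/-- The algebraic translation `⟨[t₁], …, [tₗ]⟩ ↦ ⟨[τ t₁], …, [τ tₗ]⟩` induced by a morphism. -/
noncomputable def SOEP.Hom.translation {E E₂ : SOEP.{u}} (f : SOEP.Hom E E₂) :
    Translation E.theory E₂.theory :=
  Translation.ofMap (T := E.theory) (T₂ := E₂.theory) (fun g m p => f.onCls (g m p))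
    (fun X => by
      induction f using SOEP.Hom.ind with | h f
      rfl)
    (fun {X Y Z} g h => by
      induction f using SOEP.Hom.ind with | h f
      revert g h
      refine E.hom_ind fun s => E.hom_ind fun t => ?_
      change (fun m p => f.cls.onCls (E.theoryData.comp _ _ m p)) = E₂.theoryData.comp
        (fun m p => Cls.mk (translate f.toTm (s m p)))
        (fun m p => Cls.mk (translate f.toTm (t m p)))
      rw [E.comp_mk, E₂.comp_mk (fun m p => translate f.toTm (s m p))
        (fun m p => translate f.toTm (t m p))]
      funext m p
      change Cls.mk (translate f.toTm _) = _
      simp only [Tuple.comp, Tuple.inst, translate_msubst, translate_rename])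
    (fun s => by
      induction f using SOEP.Hom.ind with | h f
      funext m p
      exact congrArg Cls.mk (translate_ofElem _ _))

theorem SOEP.Hom.translation_hom {E E₂ : SOEP.{u}} (f : SOEP.Hom E E₂) {X Y : List ℕ}
    (g : E.theory.Hom X Y) : f.translation.hom g = fun m p => f.onCls (g m p) :=
  Translation.ofMap_hom _ _ _ _ g

/-- The functor `M(-)`. -/
noncomputable def classifying : SOEP.{u} ⥤ SOAT.{u} where
  obj E := E.theory
  map f := SOEP.Hom.translation f
  map_id E := Translation.ext_hom fun X Y f => by
    rw [Translation.id_hom]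
    exact (SOEP.Hom.translation_hom _ f).trans
      (funext fun m => funext fun p => SOEP.Hom.id_onCls _)
  map_comp f g := Translation.ext_hom fun X Y h => by
    rw [Translation.comp_hom, SOEP.Hom.translation_hom]
    exact ((SOEP.Hom.translation_hom g _).trans (funext fun m => funext fun p =>
      (congrArg (SOEP.Hom.onCls g) (congrFun (congrFun (SOEP.Hom.translation_hom f h) m) p)).trans
      (SOEP.Hom.comp_onCls f g _).symm)).symm

/-! ### The internal language of a theory -/

namespace SOAT

/-- Operators of the internal language: one operator `ω_f` for each `f : (m₁, …, mₖ) ⟶ (n)`. -/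
structure ILOp (T : SOAT.{u}) : Type u where
  dom : List ℕ
  cod : ℕ
  mor : T.Hom dom [cod]

/-- The signature of the internal language: `ω_f` has arity `(m₁, …, mₖ, 0, …, 0)`, with `n` zeros. -/
abbrev ilSig (T : SOAT.{u}) : Sig.{u} := ⟨T.ILOp, fun f => f.dom ++ List.replicate f.cod 0⟩

/-- The term `t_f = ω_f((x⃗₁) 𝗆₁[x⃗₁], …, (x⃗ₖ) 𝗆ₖ[x⃗ₖ], x₁, …, xₙ)` in context
`𝗆₁ : [m₁], …, 𝗆ₖ : [mₖ] ▷ x₁, …, xₙ`. -/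
def opTm (T : SOAT.{u}) {Θ : List ℕ} {n : ℕ} (f : T.Hom Θ [n]) : Tm T.ilSig Θ n :=
  Tm.op (S := T.ilSig) (⟨Θ, n, f⟩ : T.ILOp) (Pos.app (F := fun m => Tm T.ilSig Θ (n + m)) Θ
    (fun _ p => .mvar p (fun j => .var (Fin.natAdd n j)))
    (Pos.reps (F := fun m => Tm T.ilSig Θ (n + m)) (fun i => .var (Fin.castAdd 0 i))))

/-- The equations of the internal language: `s ≈ t_{M⟨s⟩}` for elementary `s`, and
`t_{g ∘ f} ≈ t_g{𝗆ᵢ := (x⃗ᵢ) t_{fᵢ}}` for `f = ⟨f₁, …, fₗ⟩`, where `fᵢ` is `f` followed by the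
`i`-th projection. -/
inductive ILAx (T : SOAT.{u}) : ∀ {Θ : List ℕ} {n : ℕ}, Tm T.ilSig Θ n → Tm T.ilSig Θ n → Prop
  | elem {Θ : List ℕ} {n : ℕ} (s : ElemTm Θ n) :
      ILAx T (Tm.ofElem s) (T.opTm (T.map (Pos.single (F := ElemTm Θ) s)))
  | comp {Θ Ξ : List ℕ} {n : ℕ} (f : T.Hom Θ Ξ) (g : T.Hom Ξ [n]) :
      ILAx T (T.opTm (T.comp f g))
        (Tuple.inst (fun _ p => T.opTm (T.comp f (T.map (ElemTuple.proj Ξ p)))) (T.opTm g))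

/-- The internal language of a theory. -/
abbrev il (T : SOAT.{u}) : Presentation.{u} := ⟨T.ilSig, T.ILAx⟩

end SOAT

/-- Parameterisation: `Θ ▷ x₁, …, xₙ ⊢ t` becomes
`Θ, 𝗇₁ : [0], …, 𝗇ₙ : [0] ▷ · ⊢ t{xᵢ := 𝗇ᵢ[]}`. -/
def Tm.param {S : Sig.{u}} {Θ : List ℕ} {n : ℕ} (t : Tm S Θ n) :
    Tm S (Θ ++ List.replicate n 0) 0 :=
  Tm.subst (fun i => .mvar (Pos.inr Θ (Pos.rep i)) Fin.elim0)
    (Tuple.inst (fun _ p => .mvar p.inl .var) t)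

theorem Tm.param_eq {S : Sig.{u}} {Θ : List ℕ} {n : ℕ} (t : Tm S Θ n) :
    t.param = Tm.ginst (fun i => .mvar (Pos.inr Θ (Pos.rep i)) Fin.elim0)
      (fun _ p => .mvar p.inl (fun j => .var (Fin.natAdd 0 j))) t := by
  simp only [param, Tuple.inst, msubst_eq, subst_ginst, Tm.subst, Tm.rename]
  congr 1
  funext k p
  congr 1
  funext j
  exact liftS_natAdd k _ j

theorem Tm.ginst_param {S : Sig.{u}} {Θ Ξ : List ℕ} {n m : ℕ} (t : Tm S Θ n)
    (σ : ∀ k : ℕ, Pos (Θ ++ List.replicate n 0) k → Tm S Ξ (m + k)) :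
    Tm.ginst Fin.elim0 σ t.param =
      Tm.ginst (fun i => σ 0 (Pos.inr Θ (Pos.rep i))) (fun k p => σ k p.inl) t := by
  rw [param_eq, ginst_ginst]
  congr 1
  · funext i
    simp only [Tm.ginst]
    refine Eq.trans ?_ (subst_var _)
    congr 1
    exact fin_ext (fun i => by rw [Fin.addCases_left]; rfl) (fun i => i.elim0)
  · funext k p
    simp only [Tm.ginst, wk, subst_rename]
    refine Eq.trans ?_ (subst_var _)
    congr 1
    exact fin_ext (fun i => by rw [liftR_castAdd, Fin.addCases_left])
      (fun i => by rw [liftR_natAdd, Fin.addCases_right, liftS_natAdd])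

theorem Tm.translate_param {S : Sig.{u}} {S₂ : Sig.{v}} (τ : ∀ ω : S.Op, Tm S₂ (S.arity ω) 0)
    {Θ : List ℕ} {n : ℕ} (t : Tm S Θ n) : translate τ t.param = (translate τ t).param := by
  simp only [param_eq, translate_ginst, translate]
  congr 1
  funext i
  congr 1
  exact funext fun i => i.elim0

namespace Translation

variable {T T₂ T₃ : SOAT.{u}}

/-- The operator `ω_f` is sent to the parameterisation of `t_{F f}`. -/
def ilTm (F : Translation T T₂) (ω : T.ilSig.Op) : Tm T₂.ilSig (T.ilSig.arity ω) 0 :=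
  (T₂.opTm (F.hom (SOAT.ILOp.mor ω))).param

theorem param_opTm {Θ : List ℕ} {n : ℕ} (f : T.Hom Θ [n]) :
    (T.opTm f).param = gen (S₁ := T.ilSig) (⟨Θ, n, f⟩ : T.ILOp) := by
  rw [param_eq]
  refine congrArg (Tm.op (S := T.ilSig) (⟨Θ, n, f⟩ : T.ILOp)) ?_
  funext k p
  refine Pos.app_ind (P := fun k p => Tm.ginst (liftS k _) (wk k _)
    (Pos.app (F := fun m => Tm T.ilSig Θ (n + m)) _ _ _ k p) =
    Tm.mvar p (fun j => .var (Fin.natAdd 0 j))) (fun k p => ?_) (fun k p => ?_) k p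
  · rw [Pos.app_inl]
    simp only [Tm.ginst, wk, Tm.rename, Tm.subst, liftR_natAdd, Fin.addCases_right, liftS_natAdd]
  · rw [Pos.app_inr]
    refine Pos.reps_ind (P := fun k p => Tm.ginst (liftS k _) (wk k _)
      (Pos.reps (F := fun m => Tm T.ilSig Θ (n + m)) _ k p) =
      Tm.mvar (Pos.inr Θ p) (fun j => .var (Fin.natAdd 0 j))) (fun i => ?_) k p
    rw [Pos.reps_rep]
    simp only [Tm.ginst]
    rw [liftS_castAdd, Tm.rename]
    exact congrArg (Tm.mvar _) (funext fun i => i.elim0)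

theorem translate_opTm (F : Translation T T₂) {Θ : List ℕ} {n : ℕ} (f : T.Hom Θ [n]) :
    translate F.ilTm (T.opTm f) = T₂.opTm (F.hom f) := by
  rw [SOAT.opTm, translate_op]
  refine (ginst_param (T₂.opTm (F.hom f)) _).trans ?_
  refine Eq.trans ?_ (ginst_mid (T₂.opTm (F.hom f)))
  congr 1
  · funext i
    rw [Pos.app_inr, Pos.reps_rep]
    rfl
  · funext k p
    rw [Pos.app_inl]
    rfl

/-- The syntactic translation induced by an algebraic translation. -/
def synTrans (F : Translation T T₂) : SynTrans T.il T₂.il where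
  toTm := F.ilTm
  sound h := by
    cases h with
    | elem s =>
      refine .ax ?_
      change T₂.ILAx (translate F.ilTm _) (translate F.ilTm _)
      rw [translate_ofElem, translate_opTm, F.hom_map]
      exact .elem s
    | comp f g =>
      refine .ax ?_
      change T₂.ILAx (translate F.ilTm _) (translate F.ilTm _)
      simp only [Tuple.inst, translate_msubst, translate_rename, translate_opTm, F.hom_comp,
        F.hom_map]
      exact .comp (F.hom f) (F.hom g)

end Translation

/-- The functor `IL(-)`. -/
def internalLanguage : SOAT.{u} ⥤ SOEP.{u} where
  obj T := T.il
  map F := (Translation.synTrans F).cls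
  map_id T := SynTrans.cls_eq.2 fun ω => by
    change Der T.il (T.opTm (Translation.hom (𝟙 T) (SOAT.ILOp.mor ω))).param (gen (S₁ := T.ilSig) ω)
    rw [Translation.id_hom, Translation.param_opTm]
    exact .refl _
  map_comp {T T₂ T₃} F G := SynTrans.cls_eq.2 fun ω => by
    change Der T₃.il (T₃.opTm (Translation.hom (F ≫ G) (SOAT.ILOp.mor ω))).param
      (translate (Translation.ilTm G) (T₂.opTm (Translation.hom F (SOAT.ILOp.mor ω))).param)
    rw [translate_param, Translation.translate_opTm, Translation.comp_hom]
    exact .refl _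

end SecondOrder

open SecondOrder

/-! ### Tuples in `𝕄`, and substitution as composition -/

namespace SecondOrder

open Tm

/-! The heart of the matter is that, for a theory `T`, the assignment `f ↦ [t_f]` is a bijection
from morphisms `Θ ⟶ (n)` of `T` to classes of terms of its internal language. The axioms of the
internal language make the assignment functorial and compatible with `𝕄`. Since tuples correspond to
families of components, the bijection extends to all morphisms and makes the unit an isomorphism.

Injectivity comes from a semantics of the internal language in `T` itself (`eval`). At a stage `X`,
a metavariable of arity `k` is a generalised element `X ⟶ (k)`, and variables and terms are
generalised elements `X ⟶ (0)`. Since `(0)` is exponentiable and `(k)` is its `k`-fold exponential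
`(0)ᵏ ⇒ (0)`, a bound argument is interpreted at stage `X × (0)ᵏ` and transposed (`lam`). The β- and
η-laws and naturality of transposition yield the substitution lemma `eval_ginst`, hence soundness
`eval_der`. At generic arguments the value of `t_f` is the uncurrying of `f`, so `f` is recovered
from the class of `t_f` (`opTm_injective`).

Surjectivity (`representable`) is by induction on terms. Elementary terms are covered by the first
family of axioms, and closure under metasubstitution with closed abstractions by the second. The
obstacle is an operator whose arguments mix free and bound variables. Parameterisation turns the
free variables into metavariables of arity `0`, after which the operator is such a metasubstitution
instance of its generic term. Undoing the parameterisation is where the exponentials of `T` enter,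
through `of_unmate` and `of_param`.

For a presentation, the counit sends `t_{⟨[t]⟩}` back to `t` up to provable equality. With
surjectivity applied to the theory of the presentation, the counit therefore reflects provable
equality (`counit_injective`). Soundness of its inverse and one of the two inverse laws follow by
reflection, and the other law is checked on operators. -/

theorem ElemTuple.proj_single (n : ℕ) : ElemTuple.proj [n] .head = Tuple.id [n] := by
  funext m p
  cases p with
  | head => rfl
  | tail p => cases p

theorem ElemTuple.comp_proj {X Y : List ℕ} (s : ElemTuple X Y) {m : ℕ} (p : Pos Y m) :
    s.comp (ElemTuple.proj Y p) = Pos.single (F := ElemTm X) (s m p) := by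
  funext k q
  cases q with
  | head =>
    change s.inst (.mvar p .var) = s m p
    rw [Tuple.inst_mvar]
    exact subst_var _
  | tail q => cases q

/-- The tuple that consists of one morphism followed by `m` morphisms to `(0)`. -/
def Pos.consReps {F : ℕ → Type u} {n m k : ℕ} (a : F n) (b : Fin m → F k) :
    (l : ℕ) → Pos (n :: List.replicate m k) l → F l :=
  Pos.app (F := F) [n] (Pos.single (F := F) a) (Pos.reps (F := F) b)

/-- The term `𝗆[𝗇₁[x₁, …, xₖ], …, 𝗇ₘ[x₁, …, xₖ]]`. -/
def Tm.appTm {S : Sig.{u}} (k m : ℕ) : Tm S (m :: List.replicate m k) k :=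
  .mvar .head fun j => .mvar (.tail (Pos.rep j)) .var

/-- Simultaneous substitution is metasubstitution into the elementary term `𝗆[𝗇₁[x⃗], …, 𝗇ₘ[x⃗]]`.
Facts about composition of tuples thereby apply to substitution. -/
theorem Tuple.inst_consReps_appTm {S : Sig.{u}} {Y : List ℕ} {k m : ℕ} (s : Tm S Y m)
    (γ : Fin m → Tm S Y k) :
    Tuple.inst (Pos.consReps (F := Tm S Y) s γ) (appTm k m) = subst γ s := by
  rw [appTm, Tuple.inst_mvar]
  congr 1
  funext j
  rw [Tuple.inst_mvar]
  exact (subst_var _).trans (Pos.reps_rep (F := Tm S Y) γ j)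

/-! ### Finite products in a theory and values of elementary terms -/

namespace SOAT

variable {T : SOAT.{u}} {X Y Z : List ℕ} {n m : ℕ}

/-- Induction on `Y`: the object `k :: Y` is the binary product of `[k]` and `Y`, and `[]` is
terminal, so `Y` is the product of its entries. -/
theorem hom_ext {f g : T.Hom X Y}
    (h : ∀ (m : ℕ) (p : Pos Y m), T.comp f (T.map (ElemTuple.proj Y p)) =
      T.comp g (T.map (ElemTuple.proj Y p))) : f = g := by
  induction Y with
  | nil =>
    obtain ⟨t⟩ := T.terminal
    exact t.hom_ext (T.arr f) (T.arr g)
  | cons k Y ih =>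
    obtain ⟨l⟩ := T.product [k] Y
    refine BinaryFan.IsLimit.hom_ext (f := T.arr f) (g := T.arr g) l ?_ ?_
    · have e : ElemTuple.fst [k] Y = ElemTuple.proj (k :: Y) .head := by
        funext m p
        cases p with
        | head => rfl
        | tail p => cases p
      change T.comp f (T.map (ElemTuple.fst [k] Y)) = T.comp g (T.map (ElemTuple.fst [k] Y))
      rw [e]
      exact h _ .head
    · change T.comp f (T.map (ElemTuple.snd [k] Y)) = T.comp g (T.map (ElemTuple.snd [k] Y))
      refine ih fun m p => ?_
      have e : ElemTuple.proj (k :: Y) p.tail =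
          Tuple.comp (ElemTuple.snd [k] Y) (ElemTuple.proj Y p) :=
        (ElemTuple.comp_proj (ElemTuple.snd [k] Y) p).symm
      have := h _ p.tail
      rw [e, T.map_comp, ← T.assoc, ← T.assoc] at this
      exact this

theorem exists_tup (a : ∀ m : ℕ, Pos Y m → T.Hom X [m]) :
    ∃ f : T.Hom X Y, ∀ (m : ℕ) (p : Pos Y m), T.comp f (T.map (ElemTuple.proj Y p)) = a m p := by
  induction Y with
  | nil =>
    obtain ⟨t⟩ := T.terminal
    exact ⟨t.from (T.ob X), fun m p => nomatch p⟩
  | cons k Y ih =>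
    obtain ⟨g, hg⟩ := ih fun m p => a m p.tail
    obtain ⟨l⟩ := T.product [k] Y
    obtain ⟨f, h₁, h₂⟩ := BinaryFan.IsLimit.lift' l (T.arr (a k .head)) (T.arr g)
    change T.comp f (T.map (ElemTuple.fst [k] Y)) = a k .head at h₁
    change T.comp f (T.map (ElemTuple.snd [k] Y)) = g at h₂
    refine ⟨f, fun m p => ?_⟩
    cases p with
    | head =>
      rw [← h₁]
      congr 2
      funext m p
      cases p with
      | head => rfl
      | tail p => cases p
    | tail p =>
      have e : ElemTuple.proj (k :: Y) p.tail =
          Tuple.comp (ElemTuple.snd [k] Y) (ElemTuple.proj Y p) :=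
        (ElemTuple.comp_proj (ElemTuple.snd [k] Y) p).symm
      rw [e, T.map_comp, ← T.assoc]
      have := hg _ p
      rw [← h₂] at this
      exact this

/-- The morphism with given components. -/
noncomputable def tup (a : ∀ m : ℕ, Pos Y m → T.Hom X [m]) : T.Hom X Y := (exists_tup a).choose

theorem tup_proj (a : ∀ m : ℕ, Pos Y m → T.Hom X [m]) (p : Pos Y m) :
    T.comp (tup a) (T.map (ElemTuple.proj Y p)) = a m p := (exists_tup a).choose_spec m p

theorem tup_eta (f : T.Hom X Y) :
    tup (fun _ p => T.comp f (T.map (ElemTuple.proj Y p))) = f :=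
  hom_ext fun _ p => tup_proj _ p

theorem comp_tup (h : T.Hom Z X) (a : ∀ m : ℕ, Pos Y m → T.Hom X [m]) :
    T.comp h (tup a) = tup fun m p => T.comp h (a m p) :=
  hom_ext fun _ p => by rw [T.assoc, tup_proj, tup_proj]

theorem comp_proj_single (f : T.Hom X [n]) :
    T.comp f (T.map (ElemTuple.proj [n] .head)) = f := by
  rw [ElemTuple.proj_single, T.map_id, T.comp_id]

/-- The value of an elementary term at generalised elements of `[m]` for its metavariables of
arity `m`. -/
noncomputable def act (a : ∀ m : ℕ, Pos Y m → T.Hom X [m]) (s : ElemTm Y n) : T.Hom X [n] :=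
  T.comp (tup a) (T.map (Pos.single (F := ElemTm Y) s))

theorem tup_comp_map (a : ∀ m : ℕ, Pos Y m → T.Hom X [m]) (s : ElemTuple Y Z) :
    T.comp (tup a) (T.map s) = tup fun m p => act a (s m p) :=
  hom_ext fun m p => by
    rw [tup_proj, T.assoc, ← T.map_comp, ElemTuple.comp_proj]
    rfl

theorem act_mvar_var (a : ∀ m : ℕ, Pos Y m → T.Hom X [m]) (p : Pos Y m) :
    act a (.mvar p .var) = a m p := tup_proj a p

/-- Functoriality of `T.map`, read as a substitution lemma: composing tuples in `𝕄` amounts to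
evaluating in two steps. -/
theorem act_inst (a : ∀ m : ℕ, Pos Y m → T.Hom X [m]) (s : ElemTuple Y Z) (t : ElemTm Z n) :
    act a (s.inst t) = act (fun m p => act a (s m p)) t := by
  have e : Pos.single (F := ElemTm Y) (s.inst t) = s.comp (Pos.single (F := ElemTm Z) t) := by
    funext m p
    cases p with
    | head => rfl
    | tail p => cases p
  rw [act, e, T.map_comp, ← T.assoc, tup_comp_map]
  rfl

theorem comp_act (h : T.Hom Z X) (a : ∀ m : ℕ, Pos Y m → T.Hom X [m]) (s : ElemTm Y n) :
    T.comp h (act a s) = act (fun m p => T.comp h (a m p)) s := by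
  rw [act, ← T.assoc, comp_tup]
  rfl

/-- Application of a generalised element of `[m]` to generalised elements of `[0]`. -/
noncomputable def app (f : T.Hom X [m]) (γ : Fin m → T.Hom X [0]) : T.Hom X [0] :=
  act (Pos.consReps (F := fun k => T.Hom X [k]) f γ) (appTm 0 m)

theorem comp_consReps (h : T.Hom Z X) (f : T.Hom X [n]) {k : ℕ} (γ : Fin m → T.Hom X [k]) :
    (fun l p => T.comp h (Pos.consReps (F := fun k => T.Hom X [k]) f γ l p)) =
      Pos.consReps (F := fun k => T.Hom Z [k]) (T.comp h f) fun j => T.comp h (γ j) := by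
  funext l p
  cases p with
  | head => rfl
  | tail p =>
    refine Pos.reps_ind (P := fun l p =>
      T.comp h (Pos.reps (F := fun k => T.Hom X [k]) γ l p) =
        Pos.reps (F := fun k => T.Hom Z [k]) (fun j => T.comp h (γ j)) l p) (fun i => ?_) l p
    rw [Pos.reps_rep, Pos.reps_rep]

theorem act_consReps (a : ∀ m : ℕ, Pos Y m → T.Hom X [m]) (s : ElemTm Y n) {k : ℕ}
    (γ : Fin m → ElemTm Y k) :
    (fun l p => act a (Pos.consReps (F := ElemTm Y) s γ l p)) =
      Pos.consReps (F := fun k => T.Hom X [k]) (act a s) fun j => act a (γ j) := by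
  funext l p
  cases p with
  | head => rfl
  | tail p =>
    refine Pos.reps_ind (P := fun l p =>
      act a (Pos.reps (F := ElemTm Y) γ l p) =
        Pos.reps (F := fun k => T.Hom X [k]) (fun j => act a (γ j)) l p) (fun i => ?_) l p
    rw [Pos.reps_rep, Pos.reps_rep]

theorem comp_app (h : T.Hom Z X) (f : T.Hom X [m]) (γ : Fin m → T.Hom X [0]) :
    T.comp h (app f γ) = app (T.comp h f) fun j => T.comp h (γ j) := by
  rw [app, comp_act, comp_consReps]
  rfl

theorem app_zero (f : T.Hom X [0]) (γ : Fin 0 → T.Hom X [0]) : app f γ = f := by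
  rw [app, appTm]
  have e : (fun j => .mvar (.tail (Pos.rep j)) .var :
      Fin 0 → ElemTm (0 :: List.replicate 0 0) 0) = .var := funext fun i => i.elim0
  rw [e, act_mvar_var]
  rfl

theorem act_subst (a : ∀ m : ℕ, Pos Y m → T.Hom X [m]) (s : ElemTm Y m) (γ : Fin m → ElemTm Y 0) :
    act a (subst γ s) = app (act a s) fun j => act a (γ j) := by
  rw [← Tuple.inst_consReps_appTm, act_inst, act_consReps]
  rfl

/-- After parameterisation, the variables of `s` are metavariables that take the values `γ`. Laws of
`app` thus reduce to identities between elementary terms. -/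
theorem act_param (a : ∀ m : ℕ, Pos Y m → T.Hom X [m]) (s : ElemTm Y n)
    (γ : Fin n → T.Hom X [0]) :
    act (Pos.app (F := fun m => T.Hom X [m]) Y a (Pos.reps (F := fun m => T.Hom X [m]) γ))
      s.param = app (act a s) γ := by
  -- A metavariable of arity `0` has only one, empty, family of arguments. Writing it as `.var`
  -- brings `act_mvar_var` into play.
  have h : s.param = subst (fun i => .mvar (Pos.inr Y (Pos.rep i)) .var)
      (Tuple.inst (fun _ p => .mvar p.inl .var) s) := by
    rw [Tm.param]
    congr 1
    funext i
    congr 1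
    exact funext fun i => i.elim0
  rw [h, act_subst, act_inst]
  congr 1
  · congr 1
    funext m p
    rw [act_mvar_var, Pos.app_inl]
  · funext j
    rw [act_mvar_var, Pos.app_inr, Pos.reps_rep]

/-! ### Exponentials -/

/-- The projection `X × (0)ᵐ ⟶ X`. -/
def wkn (T : SOAT.{u}) (X : List ℕ) (m : ℕ) : T.Hom (X ++ List.replicate m 0) X :=
  T.map (ElemTuple.fst X _)

/-- The projections `X × (0)ᵐ ⟶ (0)`. -/
def new (T : SOAT.{u}) (X : List ℕ) (m : ℕ) (j : Fin m) :
    T.Hom (X ++ List.replicate m 0) [0] :=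
  T.map (ElemTuple.proj _ (Pos.inr X (Pos.rep j)))

theorem map_fst_proj (p : Pos X n) :
    T.comp (T.map (ElemTuple.fst X Y)) (T.map (ElemTuple.proj X p)) =
      T.map (ElemTuple.proj (X ++ Y) p.inl) := by
  rw [← T.map_comp, ElemTuple.comp_proj]
  rfl

theorem ext_wkn_new {f g : T.Hom Z (X ++ List.replicate m 0)}
    (h₁ : T.comp f (T.wkn X m) = T.comp g (T.wkn X m))
    (h₂ : ∀ j, T.comp f (T.new X m j) = T.comp g (T.new X m j)) : f = g := by
  refine hom_ext fun k p => ?_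
  refine Pos.app_ind (P := fun k p => T.comp f (T.map (ElemTuple.proj _ p)) =
    T.comp g (T.map (ElemTuple.proj _ p))) (fun k p => ?_) (fun k p => ?_) k p
  · rw [← map_fst_proj, ← T.assoc, ← T.assoc]
    exact congrArg (fun f => T.comp f _) h₁
  · exact Pos.reps_ind (P := fun k p => T.comp f (T.map (ElemTuple.proj _ (Pos.inr X p))) =
      T.comp g (T.map (ElemTuple.proj _ (Pos.inr X p)))) h₂ k p

/-- The morphism to `X × (0)ᵐ` with given components. -/
noncomputable def extend (h : T.Hom Z X) (γ : Fin m → T.Hom Z [0]) :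
    T.Hom Z (X ++ List.replicate m 0) :=
  tup (Pos.app (F := fun k => T.Hom Z [k]) X
    (fun _ p => T.comp h (T.map (ElemTuple.proj X p))) (Pos.reps (F := fun k => T.Hom Z [k]) γ))

theorem extend_wkn (h : T.Hom Z X) (γ : Fin m → T.Hom Z [0]) :
    T.comp (extend h γ) (T.wkn X m) = h :=
  hom_ext fun k p => by
    rw [wkn, T.assoc, map_fst_proj, extend, tup_proj, Pos.app_inl]

theorem extend_new (h : T.Hom Z X) (γ : Fin m → T.Hom Z [0]) (j : Fin m) :
    T.comp (extend h γ) (T.new X m j) = γ j := by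
  rw [new, extend, tup_proj, Pos.app_inr, Pos.reps_rep]

/-- Application of a generalised element of `[m + 1]` at its last argument. -/
noncomputable def appLast (f : T.Hom X [m + 1]) (x : T.Hom X [0]) : T.Hom X [m] :=
  act (Pos.consReps (F := fun k => T.Hom X [k]) f fun _ : Fin 1 => x) (ElemTuple.ev [m] m .head)

theorem comp_appLast (h : T.Hom Z X) (f : T.Hom X [m + 1]) (x : T.Hom X [0]) :
    T.comp h (appLast f x) = appLast (T.comp h f) (T.comp h x) := by
  rw [appLast, comp_act, comp_consReps]
  rfl

/-- Both sides are values of elementary terms at `f`, `γ` and `x`, so the law is a computation in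
`𝕄`: substituting for `x₁, …, xₘ` in `𝗆[x₁, …, xₘ, 𝗇[]]`. -/
theorem app_appLast (f : T.Hom X [m + 1]) (x : T.Hom X [0]) (γ : Fin m → T.Hom X [0]) :
    app (appLast f x) γ = app f (Fin.addCases (m := m) (n := 1) γ fun _ => x) := by
  rw [appLast, ← act_param]
  have e : (ElemTuple.ev [m] m .head).param = subst
      (Fin.addCases (m := m) (n := 1)
        (fun j => .mvar (Pos.inr [m + 1, 0] (Pos.rep j)) .var)
        (fun _ => .mvar (Pos.inl (Pos.inr [m + 1] .head)) .var))
      (.mvar (Pos.inl (Θ := [m + 1, 0]) .head) .var : ElemTm ([m + 1, 0] ++ _) (m + 1)) := by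
    rw [param_eq]
    simp only [ElemTuple.ev, Tm.ginst, Tm.subst]
    refine congrArg (Tm.mvar _) (fin_ext (fun j => ?_) fun j => ?_)
    · simp only [Fin.addCases_right, Fin.addCases_left, Tm.ginst]
      exact congrArg (Tm.mvar _) (funext fun i => i.elim0)
    · simp only [Fin.addCases_right, Tm.ginst, Tm.subst]
      exact congrArg (Tm.mvar _) (funext fun i => i.elim0)
  refine (congrArg _ e).trans ?_
  rw [act_subst]
  congr 1
  · rw [act_mvar_var]
    rfl
  · refine fin_ext (fun j => ?_) fun j => ?_
    · rw [Fin.addCases_left, Fin.addCases_left, act_mvar_var]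
      refine (Pos.app_inr _ _ _).trans ?_
      rw [Pos.reps_rep]
    · rw [Fin.addCases_right, Fin.addCases_right, act_mvar_var]
      rfl

/-- The universal property of `(0) ⇒ [m] = [m + 1]`, freed of the auxiliary map `g × (0)`. -/
theorem existsUnique_appLast (f : T.Hom (X ++ List.replicate 1 0) [m]) :
    ∃! g : T.Hom X [m + 1], appLast (T.comp (T.wkn X 1) g) (T.new X 1 0) = f := by
  -- The map `h` is determined by its two components, so it must be the pairing of the weakened `g`
  -- with the projection to `(0)`.
  have key : ∀ g : T.Hom X [m + 1],
      (∃ h : T.Hom (X ++ [0]) ([m].map (· + 1) ++ [0]),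
        T.comp h (T.map (ElemTuple.fst _ _)) = T.comp (T.map (ElemTuple.fst _ _)) g ∧
        T.comp h (T.map (ElemTuple.snd _ _)) = T.map (ElemTuple.snd _ _) ∧
        T.comp h (T.map (ElemTuple.ev [m])) = f) ↔
      appLast (T.comp (T.wkn X 1) g) (T.new X 1 0) = f := by
    intro g
    have e₁ : ElemTuple.fst [m + 1] [0] = ElemTuple.proj [m + 1, 0] .head := by
      funext k p
      cases p with
      | head => rfl
      | tail p => cases p
    have e₂ : ElemTuple.snd [m + 1] [0] = ElemTuple.proj [m + 1, 0] (.tail .head) := by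
      funext k p
      cases p with
      | head => rfl
      | tail p => cases p
    have e₃ : T.map (ElemTuple.snd X [0]) = T.new X 1 0 := by
      refine congrArg T.map ?_
      funext k p
      cases p with
      | head => rfl
      | tail p => cases p
    have e₄ : ElemTuple.ev [m] = Pos.single (F := ElemTm [m + 1, 0])
        (ElemTuple.ev [m] m .head) := by
      funext k p
      cases p with
      | head => rfl
      | tail p => cases p
    have c₁ : T.comp (tup (Y := [m + 1, 0])
        (Pos.consReps (F := fun k => T.Hom (X ++ List.replicate 1 0) [k])
        (T.comp (T.wkn X 1) g) fun _ : Fin 1 => T.new X 1 0)) (T.map (ElemTuple.ev [m])) =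
        appLast (T.comp (T.wkn X 1) g) (T.new X 1 0) :=
      congrArg (fun s => T.comp _ (T.map s)) e₄
    have c₂ : T.comp (tup (Y := [m + 1, 0])
        (Pos.consReps (F := fun k => T.Hom (X ++ List.replicate 1 0) [k])
        (T.comp (T.wkn X 1) g) fun _ : Fin 1 => T.new X 1 0)) (T.map (ElemTuple.fst [m + 1] [0])) =
        T.comp (T.wkn X 1) g := by
      rw [e₁]
      exact tup_proj _ _
    have c₃ : T.comp (tup (Y := [m + 1, 0])
        (Pos.consReps (F := fun k => T.Hom (X ++ List.replicate 1 0) [k])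
        (T.comp (T.wkn X 1) g) fun _ : Fin 1 => T.new X 1 0)) (T.map (ElemTuple.snd [m + 1] [0])) =
        T.new X 1 0 := by
      rw [e₂]
      exact tup_proj _ _
    constructor
    · rintro ⟨h, h₁, h₂, h₃⟩
      rw [← h₃, ← c₁]
      refine congrArg (fun s => T.comp s (T.map (ElemTuple.ev [m])))
        (hom_ext (Y := [m + 1, 0]) fun k p => ?_)
      cases p with
      | head =>
        rw [← e₁]
        exact c₂.trans h₁.symm
      | tail p =>
        cases p with
        | head =>
          rw [← e₂]
          exact c₃.trans (h₂.trans e₃).symm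
        | tail p => cases p
    · intro h
      exact ⟨_, c₂, c₃.trans e₃.symm, c₁.trans h⟩
  obtain ⟨g, hg, hu⟩ := T.exponential X [m] f
  exact ⟨g, (key g).1 hg, fun g' hg' => hu g' ((key g').2 hg')⟩

/-- Exchange of the last of `m + 1` copies of `(0)` with the others. -/
noncomputable def shiftLast (T : SOAT.{u}) (X : List ℕ) (m : ℕ) :
    T.Hom (X ++ List.replicate 1 0 ++ List.replicate m 0) (X ++ List.replicate (m + 1) 0) :=
  extend (T.comp (T.wkn _ m) (T.wkn X 1)) (Fin.addCases (m := m) (n := 1)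
    (fun j => T.new _ m j) fun _ => T.comp (T.wkn _ m) (T.new X 1 0))

/-- Inverse of `shiftLast`. -/
noncomputable def unshiftLast (T : SOAT.{u}) (X : List ℕ) (m : ℕ) :
    T.Hom (X ++ List.replicate (m + 1) 0) (X ++ List.replicate 1 0 ++ List.replicate m 0) :=
  extend (extend (T.wkn X (m + 1)) fun _ => T.new X (m + 1) (Fin.natAdd m 0))
    fun j => T.new X (m + 1) (Fin.castAdd 1 j)

/-- Evaluation consumes the last argument, so currying one argument at a time requires peeling off
the last copy of `(0)`. This composite is the only one that has to be cancelled. -/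
theorem unshiftLast_shiftLast :
    T.comp (T.unshiftLast X m) (T.shiftLast X m) = T.id _ := by
  refine ext_wkn_new ?_ fun j => ?_
  · rw [T.assoc, shiftLast, extend_wkn, ← T.assoc, unshiftLast, extend_wkn, extend_wkn, T.id_comp]
  · rw [T.assoc, shiftLast, extend_new, T.id_comp]
    refine Fin.addCases (fun j => ?_) (fun j => ?_) j
    · rw [Fin.addCases_left, unshiftLast, extend_new]
    · rw [Fin.addCases_right, ← T.assoc, unshiftLast, extend_wkn, extend_new,
        Subsingleton.elim j 0]

/-- `m`-fold exponential mates. -/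
theorem existsUnique_app (X : List ℕ) (m : ℕ) (h : T.Hom (X ++ List.replicate m 0) [0]) :
    ∃! f : T.Hom X [m], app (T.comp (T.wkn X m) f) (T.new X m) = h := by
  -- Along `shiftLast`, applying `f` to all `m + 1` new elements becomes applying it to the last one
  -- and then to the other `m`.
  have app_shift : ∀ (X : List ℕ) (m : ℕ) (f : T.Hom X [m + 1]),
      T.comp (T.shiftLast X m) (app (T.comp (T.wkn X (m + 1)) f) (T.new X (m + 1))) =
      app (T.comp (T.wkn _ m) (appLast (T.comp (T.wkn X 1) f) (T.new X 1 0))) (T.new _ m) := by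
    intro X m f
    rw [comp_app, comp_appLast, app_appLast, ← T.assoc, shiftLast, extend_wkn, T.assoc]
    congr 1
    funext j
    rw [extend_new]
  induction m generalizing X with
  | zero =>
    -- `X × (0)⁰` is isomorphic to `X` but is not the same list definitionally, so even the base
    -- case needs a transport.
    have inv : T.comp (T.wkn X 0) (extend (T.id X) Fin.elim0) = T.id _ := by
      refine ext_wkn_new ?_ fun j => j.elim0
      rw [T.assoc, extend_wkn, T.comp_id, T.id_comp]
    refine ⟨T.comp (extend (T.id X) Fin.elim0) h, ?_, ?_⟩
    · change app _ _ = _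
      rw [app_zero, ← T.assoc, inv, T.id_comp]
    · intro f hf
      change app _ _ = _ at hf
      rw [app_zero] at hf
      rw [← hf, ← T.assoc, extend_wkn, T.id_comp]
  | succ m ih =>
    obtain ⟨f₁, hf₁, u₁⟩ := ih _ (T.comp (T.shiftLast X m) h)
    obtain ⟨f, hf, u⟩ := existsUnique_appLast f₁
    change app _ _ = _ at hf₁
    change appLast _ _ = _ at hf
    refine ⟨f, ?_, fun g hg => u g (u₁ _ ?_)⟩
    · change app _ _ = _
      rw [← T.id_comp (app _ _), ← unshiftLast_shiftLast, T.assoc, app_shift, hf, hf₁, ← T.assoc,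
        unshiftLast_shiftLast, T.id_comp]
    · change app _ _ = _
      change app _ _ = _ at hg
      rw [← app_shift, hg]

/-- The mate of a morphism `X × (0)ᵐ ⟶ (0)`. -/
noncomputable def lam (h : T.Hom (X ++ List.replicate m 0) [0]) : T.Hom X [m] :=
  (existsUnique_app X m h).choose

theorem app_lam_new (h : T.Hom (X ++ List.replicate m 0) [0]) :
    app (T.comp (T.wkn X m) (lam h)) (T.new X m) = h := (existsUnique_app X m h).choose_spec.1

theorem lam_eq {h : T.Hom (X ++ List.replicate m 0) [0]} {f : T.Hom X [m]}
    (e : app (T.comp (T.wkn X m) f) (T.new X m) = h) : lam h = f :=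
  ((existsUnique_app X m h).choose_spec.2 f e).symm

theorem lam_app (f : T.Hom X [m]) : lam (app (T.comp (T.wkn X m) f) (T.new X m)) = f := lam_eq rfl

/-- The β-law: pull the defining equation of `lam h` back along `⟨id, γ⟩`. -/
theorem app_lam (h : T.Hom (X ++ List.replicate m 0) [0]) (γ : Fin m → T.Hom X [0]) :
    app (lam h) γ = T.comp (extend (T.id X) γ) h := by
  conv_rhs => rw [← app_lam_new h]
  rw [comp_app, ← T.assoc, extend_wkn, T.id_comp]
  congr 1
  funext j
  rw [extend_new]

/-- Naturality of transposition, from uniqueness of mates: the left-hand side uncurries to the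
morphism under `lam` on the right. -/
theorem comp_lam (k : T.Hom Z X) (h : T.Hom (X ++ List.replicate m 0) [0]) :
    T.comp k (lam h) = lam (T.comp (extend (T.comp (T.wkn Z m) k) (T.new Z m)) h) := by
  refine (lam_eq ?_).symm
  conv_rhs => rw [← app_lam_new h]
  rw [comp_app, ← T.assoc, ← T.assoc, extend_wkn]
  congr 1
  funext j
  rw [extend_new]

end SOAT

theorem Tm.param_mvar {S : Sig.{u}} {Θ : List ℕ} {n m : ℕ} (p : Pos Θ m) (ts : Fin m → Tm S Θ n) :
    (Tm.mvar p ts).param = .mvar p.inl fun j => (ts j).param := by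
  simp only [param_eq, Tm.ginst, Tm.subst]
  refine congrArg (Tm.mvar _) (funext fun j => ?_)
  rw [Fin.addCases_right]

theorem Der.param {E : Presentation.{u}} {Θ : List ℕ} {n : ℕ} {s t : Tm E.sig Θ n}
    (h : Der E s t) : Der E s.param t.param := by
  rw [param_eq, param_eq]
  exact h.ginst (fun _ => .refl _) fun _ _ => .refl _

namespace SOAT

variable {T : SOAT.{u}} {X Y Z Θ Ξ : List ℕ} {n m : ℕ}

/-! ### Semantics of the internal language -/

/-- The value of an operator of the internal language. -/
noncomputable def opVal (ω : T.ILOp)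
    (a : ∀ k : ℕ, Pos (ω.dom ++ List.replicate ω.cod 0) k → T.Hom X [k]) : T.Hom X [0] :=
  app (T.comp (tup fun k p => a k p.inl) ω.mor) fun j => a 0 (Pos.inr _ (Pos.rep j))

theorem comp_opVal (h : T.Hom Z X) (ω : T.ILOp)
    (a : ∀ k : ℕ, Pos (ω.dom ++ List.replicate ω.cod 0) k → T.Hom X [k]) :
    T.comp h (opVal ω a) = opVal ω fun k p => T.comp h (a k p) := by
  rw [opVal, comp_app, ← T.assoc, comp_tup]
  rfl

/-- Weakening of values of metavariables. -/
def wkMeta (k : ℕ) (σ : ∀ l : ℕ, Pos Θ l → T.Hom X [l]) (l : ℕ) (p : Pos Θ l) :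
    T.Hom (X ++ List.replicate k 0) [l] :=
  T.comp (T.wkn X k) (σ l p)

/-- Weakening of values of variables, extended to `k` new variables. -/
def wkVar (k : ℕ) (γ : Fin n → T.Hom X [0]) : Fin (n + k) → T.Hom (X ++ List.replicate k 0) [0] :=
  Fin.addCases (fun i => T.comp (T.wkn X k) (γ i)) (T.new X k)

/-- The value of a term of the internal language at generalised elements. -/
noncomputable def eval : {n : ℕ} → Tm T.ilSig Θ n → (X : List ℕ) →
    (∀ k : ℕ, Pos Θ k → T.Hom X [k]) → (Fin n → T.Hom X [0]) → T.Hom X [0]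
  | _, .var x, _, _, γ => γ x
  | _, .mvar p ts, X, σ, γ => app (σ _ p) fun j => eval (ts j) X σ γ
  | _, .op ω ts, X, σ, γ =>
    opVal ω fun k p => lam (eval (ts k p) (X ++ List.replicate k 0) (wkMeta k σ) (wkVar k γ))

theorem comp_wkMeta (h : T.Hom Z X) {k : ℕ} (γ : Fin k → T.Hom Z [0])
    (σ : ∀ l : ℕ, Pos Θ l → T.Hom X [l]) :
    (fun l p => T.comp (extend h γ) (wkMeta k σ l p)) = fun l p => T.comp h (σ l p) := by
  funext l p
  rw [wkMeta, ← T.assoc, extend_wkn]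

theorem comp_wkVar (h : T.Hom Z X) {k : ℕ} (δ : Fin k → T.Hom Z [0]) (γ : Fin n → T.Hom X [0]) :
    (fun i => T.comp (extend h δ) (wkVar k γ i)) =
      Fin.addCases (fun i => T.comp h (γ i)) δ := by
  refine fin_ext (fun i => ?_) fun j => ?_
  · rw [wkVar, Fin.addCases_left, Fin.addCases_left, ← T.assoc, extend_wkn]
  · rw [wkVar, Fin.addCases_right, Fin.addCases_right, extend_new]

/-- Stability of values under change of stage. Bound arguments are handled by naturality of
transposition, `comp_lam`. -/
theorem comp_eval (t : Tm T.ilSig Θ n) (h : T.Hom Z X) (σ : ∀ k : ℕ, Pos Θ k → T.Hom X [k])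
    (γ : Fin n → T.Hom X [0]) :
    T.comp h (eval t X σ γ) = eval t Z (fun k p => T.comp h (σ k p)) fun i => T.comp h (γ i) := by
  induction t generalizing X Z with
  | var x => rfl
  | mvar p ts ih => simp only [eval, comp_app, ih]
  | op ω ts ih =>
    simp only [eval, comp_opVal, comp_lam, ih, comp_wkMeta, comp_wkVar]
    simp only [T.assoc]
    rfl

theorem eval_rename (t : Tm T.ilSig Θ n) (ρ : Fin n → Fin m) (σ : ∀ k : ℕ, Pos Θ k → T.Hom X [k])
    (γ : Fin m → T.Hom X [0]) : eval (rename ρ t) X σ γ = eval t X σ fun i => γ (ρ i) := by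
  induction t generalizing X m with
  | var x => rfl
  | mvar p ts ih => simp only [rename, eval, ih]
  | op ω ts ih =>
    simp only [rename, eval, ih]
    congr; funext k p
    congr 2
    exact fin_ext (by simp [wkVar]) (by simp [wkVar])

theorem eval_liftS (θ : Fin n → Tm T.ilSig Θ m) (k : ℕ) (σ : ∀ k : ℕ, Pos Θ k → T.Hom X [k])
    (γ : Fin m → T.Hom X [0]) :
    (fun i => eval (liftS k θ i) _ (wkMeta k σ) (wkVar k γ)) =
      wkVar k fun i => eval (θ i) X σ γ := by
  refine fin_ext (fun i => ?_) fun j => ?_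
  · rw [liftS_castAdd, eval_rename]
    simp only [wkVar, Fin.addCases_left, comp_eval]
    rfl
  · rw [liftS_natAdd]
    simp only [eval, wkVar, Fin.addCases_right]

theorem eval_subst (t : Tm T.ilSig Θ n) (θ : Fin n → Tm T.ilSig Θ m)
    (σ : ∀ k : ℕ, Pos Θ k → T.Hom X [k]) (γ : Fin m → T.Hom X [0]) :
    eval (subst θ t) X σ γ = eval t X σ fun i => eval (θ i) X σ γ := by
  induction t generalizing X m with
  | var x => rfl
  | mvar p ts ih => simp only [subst, eval, ih]
  | op ω ts ih => simp only [subst, eval, ih, eval_liftS]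

/-- The semantic substitution lemma: an abstraction `(x⃗) s` denotes the transpose of the value of
`s` at fresh generic elements. It carries the soundness of extended metasubstitution. -/
theorem eval_ginst (t : Tm T.ilSig Θ n) (δ : Fin n → Tm T.ilSig Ξ m)
    (s : ∀ k : ℕ, Pos Θ k → Tm T.ilSig Ξ (m + k))
    (σ : ∀ k : ℕ, Pos Ξ k → T.Hom X [k]) (γ : Fin m → T.Hom X [0]) :
    eval (ginst δ s t) X σ γ =
      eval t X (fun k p => lam (eval (s k p) _ (wkMeta k σ) (wkVar k γ)))
        fun i => eval (δ i) X σ γ := by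
  induction t generalizing X m with
  | var x => rfl
  | mvar p ts ih =>
    -- The β-law `app_lam` matches substitution into the abstraction with application of its
    -- transpose.
    simp only [ginst, eval, eval_subst, app_lam, comp_eval, comp_wkMeta, comp_wkVar, T.id_comp]
    congr 1
    refine fin_ext (fun i => ?_) fun j => ?_
    · rw [Fin.addCases_left, Fin.addCases_left]
      rfl
    · rw [Fin.addCases_right, Fin.addCases_right, ih]
  | op ω ts ih =>
    simp only [ginst, eval, ih, eval_liftS]
    congr; funext k p
    congr 2
    funext l q
    -- It remains that weakening an abstraction syntactically and weakening its transpose agree: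
    -- both are evaluated at the same projections from `X × (0)ᵏ × (0)ˡ`.
    simp only [wkMeta, comp_lam, wk, eval_rename, comp_eval]
    congr 2
    · funext a b
      rw [← T.assoc, extend_wkn, T.assoc]
      rfl
    · refine fin_ext (fun i => ?_) fun j => ?_
      · rw [liftR_castAdd]
        simp only [wkVar, Fin.addCases_left]
        rw [← T.assoc, ← T.assoc, extend_wkn]
      · rw [liftR_natAdd]
        simp only [wkVar, Fin.addCases_right]
        rw [extend_new]

/-- By the η-law, each argument `𝗆ᵢ[x⃗ᵢ]` of `t_f` transposes back to the value of `𝗆ᵢ`. -/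
theorem eval_opTm (f : T.Hom Θ [n]) (σ : ∀ k : ℕ, Pos Θ k → T.Hom X [k])
    (γ : Fin n → T.Hom X [0]) : eval (T.opTm f) X σ γ = app (T.comp (tup σ) f) γ := by
  simp only [opTm, eval, opVal, Pos.app_inl, Pos.app_inr, Pos.reps_rep]
  congr 1
  · congr 2
    funext k p
    refine lam_eq ?_
    simp only [wkVar, Fin.addCases_right]
    rfl
  · funext j
    refine lam_eq ?_
    rw [app_zero, wkVar, Fin.addCases_left]

theorem eval_ofElem (s : ElemTm Θ n) (σ : ∀ k : ℕ, Pos Θ k → T.Hom X [k])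
    (γ : Fin n → T.Hom X [0]) : eval (ofElem s) X σ γ = app (act σ s) γ := by
  induction s with
  | var x =>
    rw [← act_param]
    have e : (Tm.var x : ElemTm Θ _).param = .mvar (Pos.inr Θ (Pos.rep x)) .var :=
      congrArg (Tm.mvar _) (funext fun i => i.elim0)
    rw [e, act_mvar_var, Pos.app_inr, Pos.reps_rep]
    rfl
  | mvar p ts ih =>
    have h : eval (T := T) (ofElem (.mvar p ts)) X σ γ =
        app (σ _ p) fun j => eval (ofElem (ts j)) X σ γ := rfl
    rw [h, ← act_param, Tm.param_mvar]
    have e : (Tm.mvar p.inl fun j => (ts j).param) =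
        subst (fun j => (ts j).param) (.mvar p.inl .var) := rfl
    rw [e, act_subst, act_mvar_var, Pos.app_inl]
    congr 1
    funext j
    rw [ih, act_param]
  | op ω ts => exact Empty.elim ω

/-- The semantics is sound for provable equality. -/
theorem eval_der {s t : Tm T.il.sig Θ n} (h : Der T.il s t) (X : List ℕ)
    (σ : ∀ k : ℕ, Pos Θ k → T.Hom X [k]) (γ : Fin n → T.Hom X [0]) :
    eval s X σ γ = eval t X σ γ := by
  induction h generalizing X with
  | ax h =>
    cases h with
    | elem s =>
      rw [eval_ofElem, eval_opTm]
      rfl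
    | comp f g =>
      rw [Tuple.inst, msubst_eq, eval_ginst, eval_opTm, eval_opTm]
      simp only [eval_rename, eval_opTm]
      refine congrArg₂ app ?_ rfl
      rw [← T.assoc]
      congr 1
      -- Componentwise: the transpose of the value of `t_{fᵢ}` at fresh variables is the `i`-th
      -- component of `f` at the given arguments.
      refine hom_ext fun k p => ?_
      rw [tup_proj]
      refine (lam_eq ?_).symm
      rw [← T.assoc, ← T.assoc, comp_tup, ← T.assoc]
      refine congrArg (app _) (funext fun j => ?_)
      rw [wkVar, Fin.addCases_right]
  | refl t => rfl
  | symm _ ih => exact (ih X σ γ).symm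
  | trans _ _ ih₁ ih₂ => exact (ih₁ X σ γ).trans (ih₂ X σ γ)
  | msubst _ _ ih₁ ih₂ =>
    simp only [msubst_eq, eval_ginst, eval_rename, ih₁, ih₂]

/-- Evaluate at the universal arguments, namely the projections from `Θ × (0)ⁿ`. The value of `t_f`
there is the uncurrying of `f`, so `lam` recovers `f`. -/
theorem opTm_injective {f g : T.Hom Θ [n]} (h : Der T.il (T.opTm f) (T.opTm g)) : f = g := by
  have := eval_der h (Θ ++ List.replicate n 0)
    (fun k p => T.comp (T.wkn Θ n) (T.map (ElemTuple.proj Θ p))) (T.new Θ n)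
  rw [eval_opTm, eval_opTm, tup_eta] at this
  rw [← lam_app f, this, lam_app]

end SOAT

/-! ### Every term of the internal language is represented by a morphism -/

theorem Tuple.inst_param {S : Sig.{u}} {Θ Ξ : List ℕ} {n : ℕ} (t : Tm S Θ n)
    (s : Tuple S Ξ (Θ ++ List.replicate n 0)) :
    s.inst t.param = Tm.ginst (fun i => Tm.rename (Fin.natAdd 0) (s 0 (Pos.inr Θ (Pos.rep i))))
      (fun k p => Tm.rename (Fin.natAdd 0) (s k p.inl)) t := by
  rw [Tuple.inst, msubst_eq]
  refine (congrArg (fun γ => Tm.ginst γ _ t.param) (funext fun i => i.elim0)).trans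
    (ginst_param t _)

/-- With its free variables turned into metavariables, each argument keeps only its bound variables.
The term is then the generic term of `ω` instantiated at abstractions without free variables, the
form of metasubstitution in the composition axiom. -/
theorem Tm.param_op {S : Sig.{u}} {Θ : List ℕ} {n : ℕ} (ω : S.Op)
    (ts : ∀ m : ℕ, Pos (S.arity ω) m → Tm S Θ (n + m)) :
    (Tm.op ω ts).param = Tuple.inst
      (fun k p => Tm.subst (Fin.addCases
          (fun i => .mvar (Pos.inr Θ (Pos.rep i)) Fin.elim0) .var)
        (Tuple.inst (fun _ q => .mvar q.inl .var) (ts k p))) (gen ω) := by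
  simp only [param_eq, Tuple.inst, gen, Tm.msubst, Tm.ginst, wk, subst_rename, rename_subst,
    rename_rename, subst_subst]
  congr 1
  funext k p
  simp only [msubst_eq, subst_ginst]
  congr 1
  · refine fin_ext (fun j => ?_) fun j => ?_
    · simp only [liftS_castAdd, Tm.subst, Tm.rename, Fin.addCases_left]
      exact congrArg (Tm.mvar _) (funext fun i => i.elim0)
    · simp only [liftS_natAdd, Tm.subst, Fin.addCases_right, liftR_natAdd]
  · funext l q
    simp only [liftS_natAdd, Tm.subst, Tm.rename, wk, liftR_natAdd]

namespace SOAT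

variable {T : SOAT.{u}} {X Y Z Θ Ξ : List ℕ} {n m : ℕ}

theorem der_map_proj (f : T.Hom X [n]) :
    Der T.il (T.opTm (T.comp f (T.map (ElemTuple.proj [n] .head)))) (T.opTm f) := by
  rw [comp_proj_single]
  exact .refl _

/-- The algebraic translation from a theory to the theory of its internal language. -/
noncomputable def unit (T : SOAT.{u}) : Translation T T.il.theory :=
  Translation.ofMap (T := T) (T₂ := T.il.theory)
    (fun {_ Y} f _ p => Cls.mk (T.opTm (T.comp f (T.map (ElemTuple.proj Y p)))))
    (fun X => by
      funext m p
      refine Cls.mk_eq.2 ?_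
      rw [T.id_comp]
      exact (Der.ax (ILAx.elem (.mvar p .var))).symm)
    (fun {X Y Z} f g => by
      refine Eq.trans ?_ (T.il.comp_mk (X := X) (Y := Y) (Z := Z)
        (fun m p => T.opTm (T.comp f (T.map (ElemTuple.proj Y p))))
        (fun m p => T.opTm (T.comp g (T.map (ElemTuple.proj Z p))))).symm
      funext m p
      refine Cls.mk_eq.2 ?_
      rw [T.assoc]
      -- The composition axioms of the internal language say precisely that the assignment preserves
      -- composites.
      exact Der.ax (ILAx.comp f _))
    (fun {X Y} s => by
      funext m p
      refine Cls.mk_eq.2 ?_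
      rw [← T.map_comp, ElemTuple.comp_proj]
      exact (Der.ax (ILAx.elem (s m p))).symm)

theorem unit_hom (f : T.Hom X Y) : T.unit.hom f =
    fun _ p => Cls.mk (T.opTm (T.comp f (T.map (ElemTuple.proj Y p)))) :=
  Translation.ofMap_hom _ _ _ _ f

/-- Terms of the internal language that are provably equal to some `t_f`. -/
def Representable (t : Tm T.il.sig Θ n) : Prop := ∃ f : T.Hom Θ [n], Der T.il t (T.opTm f)

namespace Representable

theorem of_der {s t : Tm T.il.sig Θ n} (h : Der T.il s t) : Representable t → Representable s :=
  fun ⟨f, hf⟩ => ⟨f, h.trans hf⟩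

theorem ofElem (s : ElemTm Θ n) : Representable (T := T) (Tm.ofElem s) := ⟨_, .ax (.elem s)⟩

/-- The composition axiom read from right to left: choose representing morphisms, tuple them and
compose. -/
theorem inst {s : Tuple T.il.sig Θ Ξ} {t : Tm T.il.sig Ξ n} (ht : Representable t)
    (hs : ∀ m p, Representable (s m p)) : Representable (s.inst t) := by
  obtain ⟨g, hg⟩ := ht
  choose a ha using hs
  refine ⟨T.comp (tup a) g, (hg.inst ha).trans ?_⟩
  refine Der.trans ?_ (Der.ax (ILAx.comp (tup a) g)).symm
  simp only [tup_proj]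
  exact .refl _

theorem subst {t : Tm T.il.sig Θ n} {θ : Fin n → Tm T.il.sig Θ m} (ht : Representable t)
    (hθ : ∀ i, Representable (θ i)) : Representable (Tm.subst θ t) := by
  rw [← Tuple.inst_consReps_appTm]
  refine inst (ofElem (appTm m n)) fun k p => ?_
  cases p with
  | head => exact ht
  | tail p =>
    refine Pos.reps_ind (P := fun k p => Representable (T := T)
      (Pos.reps (F := Tm T.il.sig Θ) θ k p)) (fun i => ?_) k p
    rw [Pos.reps_rep]
    exact hθ i

theorem renameMeta {t : Tm T.il.sig Ξ n} (ht : Representable t)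
    (ρ : ∀ m : ℕ, Pos Ξ m → Pos Θ m) :
    Representable (Tuple.inst (fun m p => .mvar (ρ m p) .var) t) :=
  ht.inst fun m p => ofElem (.mvar (ρ m p) .var)

theorem param {t : Tm T.il.sig Θ n} (ht : Representable t) : Representable t.param :=
  (ht.renameMeta fun _ p => p.inl).subst fun i =>
    -- The embedded elementary term has a different, equally empty, family of arguments, so
    -- congruence holds vacuously.
    ofElem (.mvar (Pos.inr Θ (Pos.rep i)) Fin.elim0) |> of_der (by
      refine Der.mvar _ fun j => j.elim0)

/-- The unit carries the evaluation equation for `g` in `T` to the theory of the internal language,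
where uncurrying is the syntactic operation `unmate`. -/
theorem der_unmate (f : T.Hom (X ++ [0]) [m]) :
    ∃ g : T.Hom X [m + 1], Der T.il (T.opTm f) (Presentation.unmate (T.opTm g)) := by
  obtain ⟨g, ⟨h, h₁, h₂, h₃⟩, -⟩ := T.exponential X [m] f
  refine ⟨g, ?_⟩
  -- The equations characterising `h` as `g × (0)` involve only composites and images of `𝕄`, so the
  -- unit preserves them.
  have := T.il.comp_ev (Y := [m]) (T.unit.hom g) (T.unit.hom h)
    (by
      have e := congrArg T.unit.hom h₁
      rw [Translation.hom_comp, Translation.hom_comp, Translation.hom_map,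
        Translation.hom_map] at e
      exact e)
    (by
      have e := congrArg T.unit.hom h₂
      rw [Translation.hom_comp, Translation.hom_map, Translation.hom_map] at e
      exact e)
  have e : T.il.theory.comp (T.unit.hom h) (T.il.theory.map (ElemTuple.ev [m])) =
      T.unit.hom f := by
    rw [← h₃, Translation.hom_comp, Translation.hom_map]
  have := congrFun (congrFun (e.symm.trans this) m) .head
  rw [unit_hom, unit_hom] at this
  refine (der_map_proj f).symm.trans ((Cls.mk_eq.1 this).trans ?_)
  exact T.il.der_unmate ((Cls.rep_mk _).trans (der_map_proj g))

/-- If `f` represents the uncurried term, its exponential mate represents `t`, because `mate`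
inverts `unmate` and respects provable equality. -/
theorem of_unmate {t : Tm T.il.sig X (m + 1)} (h : Representable (Presentation.unmate t)) :
    Representable t := by
  obtain ⟨f, hf⟩ := h
  obtain ⟨g, hg⟩ := der_unmate f
  refine ⟨g, ?_⟩
  have := T.il.der_mate (hf.trans hg)
  rwa [Presentation.mate_unmate, Presentation.mate_unmate] at this

/-- Variables are restored one at a time by `of_unmate`. In between, the metavariable contexts
differ only by a renaming. -/
theorem of_param {t : Tm T.il.sig Θ n} (h : Representable t.param) : Representable t := by
  induction n generalizing Θ with
  | zero =>
    -- With no variables, `t.param` lives over `Θ ++ []`, and a renaming of metavariables takes it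
    -- back to `Θ`.
    have e : t = Tuple.inst (fun m p => .mvar (Pos.app (F := Pos Θ) Θ (fun _ p => p)
        (Pos.reps (F := Pos Θ) Fin.elim0) m p) .var) t.param := by
      rw [Tuple.inst_param]
      conv_lhs => rw [← ginst_mid t]
      congr 1
      · exact funext fun i => i.elim0
      · funext k p
        rw [Pos.app_inl]
        rfl
    rw [e]
    exact h.renameMeta _
  | succ n ih =>
    refine of_unmate (ih ?_)
    -- Since `unmate` converts the last variable first, its metavariable stands directly after `Θ`.
    -- The term is otherwise `t.param`.
    have e : (Presentation.unmate t).param = Tuple.inst (fun m p => .mvar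
        (Pos.app (F := Pos (Θ ++ [0] ++ List.replicate n 0)) Θ (fun _ p => p.inl.inl)
          (Pos.reps (F := Pos (Θ ++ [0] ++ List.replicate n 0))
            (Fin.addCases (m := n) (n := 1) (fun j => Pos.inr _ (Pos.rep j))
              fun _ => (Pos.inr Θ .head).inl)) m p) .var) t.param := by
      rw [Tuple.inst_param, param_eq, Presentation.unmate, ginst_ginst]
      congr 1
      · refine fin_ext (fun j => ?_) fun j => ?_
        · rw [Fin.addCases_left, Pos.app_inr, Pos.reps_rep, Fin.addCases_left]
          exact congrArg (Tm.mvar _) (funext fun i => i.elim0)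
        · rw [Fin.addCases_right, Pos.app_inr, Pos.reps_rep, Fin.addCases_right]
          simp only [Tm.ginst, Tm.subst]
          exact congrArg (Tm.mvar _) (funext fun i => i.elim0)
      · funext k p
        rw [Pos.app_inl]
        simp only [Tm.ginst, wk, Tm.rename, Tm.subst, liftR_natAdd, Fin.addCases_right, liftS_natAdd]
    rw [e]
    exact h.renameMeta _

theorem op (ω : T.ILOp) {ts : ∀ m : ℕ, Pos (T.ilSig.arity ω) m → Tm T.ilSig Θ (n + m)}
    (h : ∀ m p, Representable (T := T) (ts m p)) :
    Representable (T := T) (Tm.op (S := T.ilSig) ω ts) := by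
  refine of_param ?_
  rw [Tm.param_op]
  refine inst ?_ fun k p => ?_
  -- The generic term of `ω_f` is the parameterisation of `t_f`.
  · have := param (T := T) ⟨ω.mor, .refl _⟩
    rwa [Translation.param_opTm] at this
  · refine ((h k p).renameMeta _).subst fun i => ?_
    refine Fin.addCases (fun i => ?_) (fun i => ?_) i
    · rw [Fin.addCases_left]
      exact of_der (Der.mvar _ fun j => j.elim0)
        (ofElem (.mvar (Pos.inr Θ (Pos.rep i)) Fin.elim0))
    · rw [Fin.addCases_right]
      exact ofElem (.var i)

end Representable

/-- Every term of the internal language is provably equal to some `t_f`. -/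
theorem representable (t : Tm T.il.sig Θ n) : Representable t := by
  induction t with
  | var x => exact Representable.ofElem (.var x)
  | mvar p ts ih => exact (Representable.ofElem (.mvar p .var)).subst ih
  | op ω ts ih => exact Representable.op ω ih

end SOAT

/-! ### The unit is an isomorphism -/

theorem Translation.isIso_of_bijective {T T₂ : SOAT.{u}} (F : T ⟶ T₂)
    (h : ∀ X Y : List ℕ, Function.Bijective (Translation.hom F : T.Hom X Y → T₂.Hom X Y)) :
    IsIso F := by
  let e (X Y : List ℕ) : T.Hom X Y ≃ T₂.Hom X Y := Equiv.ofBijective _ (h X Y)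
  have he {X Y : List ℕ} (g : T₂.Hom X Y) : Translation.hom F ((e X Y).symm g) = g :=
    (e X Y).apply_symm_apply g
  -- Functoriality and compatibility with `𝕄` pass to the inverse bijections, and cartesianness is
  -- then automatic by `Translation.preserves`.
  let G : T₂ ⟶ T := Translation.ofMap (T := T₂) (T₂ := T) (fun {X Y} g => (e X Y).symm g)
    (fun X => (h X X).1 (by rw [he, Translation.hom_id]))
    (fun f g => (h _ _).1 (by rw [he, Translation.hom_comp, he, he]))
    (fun s => (h _ _).1 (by rw [he, Translation.hom_map]))
  have hG {X Y : List ℕ} (g : T₂.Hom X Y) : Translation.hom G g = (e X Y).symm g :=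
    Translation.ofMap_hom _ _ _ _ g
  refine ⟨G, Translation.ext_hom fun X Y f => ?_, Translation.ext_hom fun X Y f => ?_⟩
  · rw [Translation.id_hom]
    refine (Translation.comp_hom F G f).trans ?_
    rw [hG]
    exact (e X Y).symm_apply_apply f
  · rw [Translation.id_hom]
    refine (Translation.comp_hom G F f).trans ?_
    rw [hG, he]

namespace SOAT

variable {T : SOAT.{u}} {X Y Z Θ Ξ : List ℕ} {n m : ℕ}

/-- Faithfulness is `opTm_injective` on components, and fullness is `representable` on components.
-/
theorem unit_bijective (X Y : List ℕ) :
    Function.Bijective (Translation.hom T.unit : T.Hom X Y → T.il.theory.Hom X Y) := by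
  constructor
  · intro f g h
    rw [unit_hom, unit_hom] at h
    exact hom_ext fun m p => opTm_injective (Cls.mk_eq.1 (congrFun (congrFun h m) p))
  · refine T.il.hom_ind fun s => ?_
    choose a ha using fun m p => representable (s m p)
    refine ⟨tup a, ?_⟩
    rw [unit_hom]
    funext m p
    rw [tup_proj]
    exact Cls.mk_eq.2 (ha m p).symm

/-- The unit of the equivalence. -/
noncomputable def unitIso : 𝟭 SOAT.{u} ≅ internalLanguage ⋙ classifying :=
  have : ∀ T : SOAT.{u}, IsIso (X := T) (Y := T.il.theory) T.unit := fun _ =>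
    Translation.isIso_of_bijective _ unit_bijective
  NatIso.ofComponents (fun T => asIso (X := T) (Y := T.il.theory) T.unit) fun {T T₂} F => by
    refine Translation.ext_hom fun X Y f => ?_
    refine (Translation.comp_hom F T₂.unit f).trans
      (Eq.trans ?_ (Translation.comp_hom T.unit (classifying.map (internalLanguage.map F)) f).symm)
    refine Eq.trans ?_ (SOEP.Hom.translation_hom (internalLanguage.map F) _).symm
    rw [unit_hom, unit_hom]
    funext m p
    change _ = Cls.mk (E := T₂.il) (translate (Translation.ilTm F) (T.opTm _))
    rw [Translation.translate_opTm, Translation.hom_comp, Translation.hom_map]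

end SOAT

/-! ### The counit and its inverse -/

namespace Presentation

variable (E : Presentation.{u}) {X Y Z Θ Ξ : List ℕ} {n m : ℕ}

/-- The class `c` of a tuple `⟨c⟩` of length one. -/
def entry (f : E.theory.Hom Θ [n]) : Cls E Θ n := f n .head

/-- The operator `ω_{⟨[t]⟩}` is sent to the parameterisation of `t`. -/
noncomputable def counitTm (ω : E.theory.ILOp) : Tm E.sig (E.theory.ilSig.arity ω) 0 :=
  (Cls.rep (E.entry ω.mor)).param

/-- In `t_f` the parameters `𝗇ᵢ[]` are filled with the variables `xᵢ` again, which undoes the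
parameterisation in `counitTm`. -/
theorem translate_counitTm_opTm (f : E.theory.Hom Θ [n]) :
    translate E.counitTm (E.theory.opTm f) = Cls.rep (E.entry f) := by
  rw [SOAT.opTm, translate_op]
  refine (ginst_param (Cls.rep (E.entry f)) _).trans ?_
  refine Eq.trans ?_ (ginst_mid _)
  congr 1
  · funext i
    rw [Pos.app_inr, Pos.reps_rep]
    rfl
  · funext k p
    rw [Pos.app_inl]
    rfl

/-- The counit of the equivalence at a presentation. -/
noncomputable def counit : SynTrans E.theory.il E where
  toTm := E.counitTm
  sound h := by
    cases h with
    | elem s =>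
      rw [translate_ofElem]
      refine Der.trans ?_ (Eq.subst (motive := Der E _) (E.translate_counitTm_opTm _).symm
        (.refl _))
      exact (Cls.rep_mk _).symm
    | @comp Ξ _ f g =>
      simp only [Tuple.inst, translate_msubst, translate_rename, translate_counitTm_opTm]
      refine (Cls.rep_mk _).trans ((Der.refl _).inst fun m p => ?_)
      refine Cls.mk_eq.1 ?_
      rw [Cls.mk_rep, Cls.mk_rep]
      -- Composition in the theory is metasubstitution of chosen representatives. It remains to see
      -- that following `f` by a projection picks out the entry of `f`.
      have := congrFun (congrFun (E.comp_mvar (Z := [m]) f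
        (Pos.single (F := fun k => Pos Ξ k) p)) m) .head
      refine this.symm.trans ?_
      congr 2

/-- The counit reflects provable equality: both terms are provably some `t_f` and `t_g`, and their
images represent the single classes that make up `f` and `g`, so `f = g`. -/
theorem counit_injective {s t : Tm E.theory.il.sig Θ n}
    (h : Der E (translate (S₁ := E.theory.ilSig) E.counitTm s)
      (translate (S₁ := E.theory.ilSig) E.counitTm t)) : Der E.theory.il s t := by
  obtain ⟨f, hf⟩ := SOAT.representable s
  obtain ⟨g, hg⟩ := SOAT.representable t
  have := (E.counit.der hf).symm.trans (h.trans (E.counit.der hg))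
  change Der E (translate E.counitTm (E.theory.opTm f))
    (translate E.counitTm (E.theory.opTm g)) at this
  rw [translate_counitTm_opTm, translate_counitTm_opTm, ← Cls.mk_eq, Cls.mk_rep, Cls.mk_rep] at this
  have e : f = g := by
    funext m p
    cases p with
    | head => exact this
    | tail p => cases p
  subst e
  exact hf.trans hg.symm

/-- The term of the internal language to which the inverse of the counit sends an operator. -/
noncomputable def counitInvTm (ω : E.sig.Op) : Tm E.theory.il.sig (E.sig.arity ω) 0 :=
  E.theory.opTm (Pos.single (F := Cls E (E.sig.arity ω)) (Cls.mk (Tm.gen ω)))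

/-- Translations that agree on operators agree on terms. The operator `ω` returns as a
representative of the class of its generic term. -/
theorem der_counit_counitInv (t : Tm E.sig Θ n) :
    Der E (translate (S₁ := E.theory.ilSig) E.counitTm (translate E.counitInvTm t)) t := by
  rw [translate_translate]
  conv => rhs; rw [← translate_gen t]
  refine SynTrans.der_congr (fun ω => ?_) t
  have := E.translate_counitTm_opTm (Θ := E.sig.arity ω) (n := 0)
    (Pos.single (F := Cls E (E.sig.arity ω)) (Cls.mk (Tm.gen ω)))
  rw [counitInvTm]
  exact Eq.subst (motive := fun r => Der E r _) this.symm (Cls.rep_mk _)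

/-- The inverse of the counit at a presentation. -/
noncomputable def counitInv : SynTrans E E.theory.il where
  toTm := E.counitInvTm
  -- An axiom of `E` need not be derived inside the internal language: the counit takes both sides
  -- back to the axiom, and provable equality is reflected.
  sound h := E.counit_injective ((E.der_counit_counitInv _).trans
    ((Der.ax h).trans (E.der_counit_counitInv _).symm))

theorem counit_comp_counitInv : SOEP.Hom.comp E.counit.cls E.counitInv.cls = 𝟙 E.theory.il :=
  SynTrans.cls_eq.2 fun ω => by
    -- After a further application of the counit, both sides become the image of `ω` under it.
    refine E.counit_injective ((E.der_counit_counitInv _).trans ?_)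
    change Der E (E.counitTm ω) (translate E.counitTm (gen ω))
    rw [translate_gen_op]
    exact .refl _

theorem counitInv_comp_counit : SOEP.Hom.comp E.counitInv.cls E.counit.cls = 𝟙 E :=
  SynTrans.cls_eq.2 fun ω => by
    change Der E (translate (S₁ := E.theory.ilSig) E.counitTm (E.counitInvTm ω)) (gen ω)
    rw [← translate_gen_op E.counitInvTm ω]
    exact E.der_counit_counitInv _

/-- The counit of the equivalence. -/
noncomputable def counitIso : classifying ⋙ internalLanguage ≅ 𝟭 SOEP.{u} :=
  NatIso.ofComponents (fun E => ⟨E.counit.cls, E.counitInv.cls, E.counit_comp_counitInv,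
    E.counitInv_comp_counit⟩) fun {E E₂} f => by
    refine SOEP.Hom.ind (P := fun f : SOEP.Hom E E₂ =>
      SOEP.Hom.comp (internalLanguage.map (classifying.map f)) E₂.counit.cls =
        SOEP.Hom.comp E.counit.cls f) (fun τ => SynTrans.cls_eq.2 fun (ω : E.theory.ILOp) => ?_) f
    change Der E₂ (translate E₂.counitTm
      (E₂.theory.opTm (Translation.hom τ.cls.translation ω.mor)).param)
      (translate τ.toTm (Cls.rep (E.entry ω.mor)).param)
    rw [translate_param, translate_param, translate_counitTm_opTm, SOEP.Hom.translation_hom]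
    refine Der.param (Cls.mk_eq.1 ?_)
    rw [Cls.mk_rep]
    change SOEP.Hom.onCls τ.cls (E.entry ω.mor) = _
    conv_lhs => rw [← Cls.mk_rep (E.entry ω.mor)]
    rfl

end Presentation

/-! ### The triangle identity and the equivalence -/

theorem unit_counit_triangle (T : SOAT.{u}) :
    internalLanguage.map (SOAT.unitIso.hom.app T) ≫
      Presentation.counitIso.hom.app (internalLanguage.obj T) = 𝟙 (internalLanguage.obj T) :=
  SynTrans.cls_eq.2 fun (ω : T.ILOp) => by
    change Der T.il (translate T.il.counitTm
      (T.il.theory.opTm (Translation.hom T.unit ω.mor)).param) (gen (S₁ := T.ilSig) ω)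
    rw [translate_param, Presentation.translate_counitTm_opTm, SOAT.unit_hom,
      ← Translation.param_opTm]
    -- The unit sends `f` to `⟨[t_f]⟩` and the counit picks a representative of that class, so both
    -- sides are parameterisations of terms provably equal to `t_f`.
    exact Der.param ((Cls.rep_mk _).trans (SOAT.der_map_proj _))

end SecondOrder

theorem theorem6p6 :
    ∃ e : SOAT.{u} ≌ SOEP.{u},
      ∃ (η : 𝟭 SOAT.{u} ≅ internalLanguage ⋙ classifying)
        (ε : classifying ⋙ internalLanguage ≅ 𝟭 SOEP.{u})
        (tri : ∀ T : SOAT.{u}, internalLanguage.map (η.hom.app T) ≫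
          ε.hom.app (internalLanguage.obj T) = 𝟙 (internalLanguage.obj T)),
        e = ⟨internalLanguage, classifying, η, ε, tri⟩ ∧
        (∀ (T : SOAT.{u}) (Θ Ξ : List ℕ) (f : T.Hom Θ Ξ),
          Translation.hom (η.hom.app T) f = fun _ p =>
            Cls.mk (T.opTm (T.comp f (T.map (ElemTuple.proj Ξ p))))) ∧
        (∀ (E : SOEP.{u}) (ω : E.sig.Op),
          SOEP.Hom.app (ε.inv.app E) ω =
            Cls.mk (E.theory.opTm (Pos.single (F := Cls E (E.sig.arity ω)) (Cls.mk (Tm.gen ω))))) ∧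
        (∀ (E : SOEP.{u}) (Θ : List ℕ) (n : ℕ) (t : Tm E.sig Θ n),
          SOEP.Hom.app (ε.hom.app E)
            (⟨Θ, n, Pos.single (F := Cls E Θ) (Cls.mk t)⟩ : E.theory.ILOp) = Cls.mk t.param) := by
  -- One triangle identity suffices for an adjoint equivalence, since the other then follows from
  -- invertibility of unit and counit.
  refine ⟨⟨internalLanguage, classifying, SOAT.unitIso, Presentation.counitIso,
    unit_counit_triangle⟩, SOAT.unitIso, Presentation.counitIso, unit_counit_triangle, rfl, ?_⟩
  exact ⟨fun T Θ Ξ f => SOAT.unit_hom f, fun E ω => rfl,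
    fun E Θ n t => Cls.mk_eq.2 (Der.param (Cls.rep_mk t))⟩
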